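/- A binary structure is a pair $\mathbb{X}=\langle X,\rho\rangle$ with $\rho\subseteq X\times X$; let $\mathbb{X}^c=\langle X,X^2\setminus\rho\rangle$ and $\mathbb{X}_{re}=\langle X,\rho\cup\Delta_X\rangle$. The components of $\mathbb{X}$ are the classes of the least equivalence relation on $X$ containing $\rho$; $\mathbb{X}$ is connected if it has exactly one component, and biconnected if $\mathbb{X}$ and $\mathbb{X}^c$ are both connected. $\mathbb{X}$ is ultrahomogeneous if each isomorphism between finite substructures of $\mathbb{X}$ extends to an automorphism of $\mathbb{X}$. A digraph is a structure with irreflexive and asymmetric relation. The enlargement $\mathbb{Y}_e$ of $\mathbb{Y}=\langle Y,\tau\rangle$ has domain $Y$ and the relation $x\,\tau_e\,y\Leftrightarrow x\,\tau\,y\lor(x\neq y\land\neg\, x\,\tau\,y\land\neg\, y\,\tau\,x)$, and $\bigcup_\kappa\mathbb{Y}_e$ is the disjoint union of $\kappa$ copies of $\mathbb{Y}_e$. $\mathbb{P}(\mathbb{X})$ is the set of all $A\subseteq X$ such that the substructure of $\mathbb X$ on $A$ is isomorphic to $\mathbb{X}$, ordered by inclusion. For a pre-order $P$, let $p\leq^*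 q$ mean that each $r\leq p$ has some $s\leq r$ with $s\leq q$. The separative quotient $\mathrm{sq}\,P$ is the partial order induced by $\leq^*$ on the classes of $p=^*q\Leftrightarrow p\leq^*q\land q\leq^*p$. $P$ is atomless if below each $p\in P$ there are two elements with no common lower bound; $P$ is $\omega_1$-closed if every decreasing sequence in $P$ of length $\gamma<\omega_1$ has a lower bound in $P$. Two pre-orders are forcing equivalent if their Boolean completions (algebras of regular open sets in the topology of downward closed sets) are isomorphic. $(P(\omega)/\mathrm{Fin})^+$ is the set of nonzero elements of the Boolean algebra $P(\omega)/\mathrm{Fin}$. Theorem. Let $\mathbb{X}$ be a non-empty, countable (finite or countably infinite), reflexive or irreflexive, ultrahomogeneous binary structure that is not biconnected. Then there are an ultrahomogeneous digraph $\mathbb{Y}$ and a cardinal $\kappa>1$ such that $\mathbb{X}$ is isomorphic to one of $$\textstyle\bigcup_\kappa\mathbb{Y}_e,\qquad(\bigcup_\kappa\mathbb{Y}_e)_{re},\qquad(\bigcup_\kappa\mathbb{Y}_e)^c,\qquad((\bigcup_\kappa\mathbb{Y}_e)_{re})^c,$$ and for all such $\mathbb{Y}$ and $\kappa$ the following holds.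 (i) If $\kappa<\omega$ and $\mathbb{Y}$ has finitely many components, then $\mathbb{P}(\mathbb{X})\cong\mathbb{P}(\mathbb{Z})^n$ (as partial orders) for some biconnected ultrahomogeneous digraph $\mathbb{Z}$ and some integer $n\geq 2$. (ii) If $\kappa=\omega$ or $\mathbb{Y}$ has infinitely many components, then $\mathrm{sq}\,\mathbb{P}(\mathbb{X})$ is atomless and $\omega_1$-closed and, if the Continuum Hypothesis holds, $\mathrm{sq}\,\mathbb{P}(\mathbb{X})$ is forcing equivalent to $(P(\omega)/\mathrm{Fin})^+$. -/

import Mathlib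

/-! Binary structures are pairs of a type `X` and a relation `r : X → X → Prop`.
Embeddings are `r ↪r s` (injective, preserving and reflecting the relation) and isomorphisms
are `r ≃r s`. -/

universe u v w

namespace BinStr

section Structures

variable {X : Type u}

/-- The substructure of `⟨X, r⟩` on the subset `A`. -/
def sub (r : X → X → Prop) (A : Set X) : A → A → Prop := fun a b => r a b

/-- `⟨X, r⟩` is ultrahomogeneous: every isomorphism between finite substructures (that is, every
embedding of a finite substructure) extends to an automorphism. -/
def IsUltrahomogeneous (r : X → X → Prop) : Prop :=
  ∀ A : Set X, A.Finite → ∀ φ : sub r A ↪r r, ∃ f : r ≃r r, ∀ a : A, f a = φ a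

/-- The set of connectivity components: the quotient by the least equivalence relation
containing `r`. -/
def Components (r : X → X → Prop) : Type u := Quotient (Relation.EqvGen.setoid r)

/-- A structure is connected iff it has exactly one component. -/
def IsConnected (r : X → X → Prop) : Prop := Cardinal.mk (Components r) = 1

/-- The complement of a structure. -/
def compl (r : X → X → Prop) : X → X → Prop := fun x y => ¬ r x y

/-- The reflexification of a structure. -/
def reflexification (r : X → X → Prop) : X → X → Prop := fun x y => r x y ∨ x = y

/-- The enlargement of a structure. -/
def enlargement (r : X → X → Prop) : X → X → Prop :=
  fun x y => r x y ∨ (x ≠ y ∧ ¬ r x y ∧ ¬ r y x)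

/-- The disjoint union of copies of `⟨X, r⟩` indexed by `I`. -/
def disjointCopies (I : Type v) (r : X → X → Prop) : I × X → I × X → Prop :=
  fun p q => p.1 = q.1 ∧ r p.2 q.2

/-- A structure is biconnected iff it and its complement are connected. -/
def IsBiconnected (r : X → X → Prop) : Prop := IsConnected r ∧ IsConnected (compl r)

/-- A digraph is an irreflexive and asymmetric structure. -/
def IsDigraph (r : X → X → Prop) : Prop := (∀ x, ¬ r x x) ∧ ∀ x y, ¬ r x y ∨ ¬ r y x

/-- `⟨Y, s⟩` is an ultrahomogeneous digraph, `κ > 1` is a cardinal, and `⟨X, r⟩` is isomorphic to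
the disjoint union of `κ` copies of the enlargement of `⟨Y, s⟩`, or to the reflexification of
this union, or to the complement of one of these two structures. -/
def IsRepresentedBy {Y : Type v} (r : X → X → Prop) (s : Y → Y → Prop)
    (κ : Cardinal.{w}) : Prop :=
  IsDigraph s ∧ IsUltrahomogeneous s ∧ 1 < κ ∧
    (Nonempty (r ≃r disjointCopies κ.out (enlargement s)) ∨
      Nonempty (r ≃r reflexification (disjointCopies κ.out (enlargement s))) ∨
      Nonempty (r ≃r compl (disjointCopies κ.out (enlargement s))) ∨
      Nonempty (r ≃r compl (reflexification (disjointCopies κ.out (enlargement s)))))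

/-- The poset (under inclusion) of all domains of substructures of `⟨X, r⟩` isomorphic to
`⟨X, r⟩`. -/
abbrev Copies (r : X → X → Prop) : Type u := {A : Set X // Nonempty (sub r A ≃r r)}

/-- The copies of a structure are exactly the ranges of its self-embeddings. -/
theorem nonempty_sub_relIso_iff (r : X → X → Prop) (A : Set X) :
    Nonempty (sub r A ≃r r) ↔ ∃ f : r ↪r r, Set.range f = A := by
  constructor
  · rintro ⟨e⟩
    refine ⟨⟨⟨fun x => (e.symm x : X), fun x y h => e.symm.injective (Subtype.ext h)⟩, ?_⟩, ?_⟩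
    · intro a b
      exact e.symm.map_rel_iff
    · ext x
      constructor
      · rintro ⟨y, rfl⟩
        exact (e.symm y).2
      · intro hx
        exact ⟨e ⟨x, hx⟩, congrArg Subtype.val (e.symm_apply_apply ⟨x, hx⟩)⟩
  · rintro ⟨f, rfl⟩
    exact ⟨(RelIso.mk (Equiv.ofInjective f f.injective) (fun {a b} => f.map_rel_iff)).symm⟩

end Structures

section Posets

/-- `p` is an atom of a pre-order: any two elements below `p` are compatible. -/
def IsForcingAtom {P : Type u} [Preorder P] (p : P) : Prop :=
  ∀ q r : P, q ≤ p → r ≤ p → ∃ t : P, t ≤ q ∧ t ≤ r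

/-- A pre-order is atomless iff it has no atoms. -/
def IsAtomlessOrder (P : Type u) [Preorder P] : Prop := ∀ p : P, ¬ IsForcingAtom p

/-- A pre-order is `κ`-closed iff every decreasing sequence of length `γ < κ` has a lower
bound. -/
def IsClosedOrder (κ : Cardinal.{v}) (P : Type u) [Preorder P] : Prop :=
  ∀ γ : Ordinal.{v}, γ < κ.ord → ∀ p : Set.Iio γ → P,
    (∀ α β, α < β → p β ≤ p α) → ∃ q : P, ∀ α, q ≤ p α

/-- The carrier of the separative modification of a pre-order. -/
structure SepMod (P : Type u) where
  /-- The underlying element. -/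
  val : P

/-- The separative modification: `p ≤* q` iff every `r ≤ p` has some `t ≤ r` with `t ≤ q`. -/
instance SepMod.instPreorder (P : Type u) [Preorder P] : Preorder (SepMod P) where
  le p q := ∀ r : P, r ≤ p.val → ∃ t : P, t ≤ r ∧ t ≤ q.val
  le_refl p r h := ⟨r, le_rfl, h⟩
  le_trans p q s hpq hqs r hr := by
    obtain ⟨t, htr, htq⟩ := hpq r hr
    obtain ⟨t', ht't, ht's⟩ := hqs t htq
    exact ⟨t', ht't.trans htr, ht's⟩

/-- The separative quotient: the separative modification modulo `p ≤* q ∧ q ≤* p`. -/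
abbrev SepQuot (P : Type u) [Preorder P] : Type u :=
  Antisymmetrization (SepMod P) (· ≤ ·)

/-- The Boolean completion of a pre-order: the algebra of regular open sets of the topology whose
open sets are the lower sets, i.e. the lower sets `A` with `Aᶜᶜ = A` for the pseudocomplement. -/
abbrev BooleanCompletion (P : Type u) [Preorder P] : Type u := Heyting.Regular (LowerSet P)

/-- Two pre-orders are forcing equivalent iff they have isomorphic Boolean completions. -/
def ForcingEquivalent (P : Type u) (Q : Type v) [Preorder P] [Preorder Q] : Prop :=
  Nonempty (BooleanCompletion P ≃o BooleanCompletion Q)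

/-- The carrier of the pre-order of all subsets of `ω` under almost inclusion. -/
structure AlmostSet where
  /-- The underlying set of natural numbers. -/
  val : Set ℕ

/-- Almost inclusion: `A ≤ B` iff `A \ B` is finite. -/
instance AlmostSet.instPreorder : Preorder AlmostSet where
  le A B := (A.val \ B.val).Finite
  le_refl A := by simp
  le_trans A B C hAB hBC := (hAB.union hBC).subset (by
    intro x hx
    by_cases hB : x ∈ B.val
    · exact Or.inr ⟨hB, hx.2⟩
    · exact Or.inl ⟨hx.1, hB⟩)

/-- The Boolean algebra `P(ω)/Fin`, as a poset. -/
abbrev PowModFin : Type := Antisymmetrization AlmostSet (· ≤ ·)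

/-- The poset `(P(ω)/Fin)⁺` of nonzero elements of `P(ω)/Fin`. -/
abbrev PowModFinPos : Type :=
  {a : PowModFin // a ≠ toAntisymmetrization (· ≤ ·) (AlmostSet.mk ∅)}

/-- The Continuum Hypothesis. -/
def CH : Prop := (2 : Cardinal.{0}) ^ Cardinal.aleph0 = Cardinal.aleph 1

end Posets

end BinStr

/-! Deleting the diagonal and passing to the complement reduce the representation to an irreflexive
disconnected ultrahomogeneous structure. Its components are complete: if x and y are unrelated in
one component and z lies in another, the map fixing x and sending y to z extends to an automorphism,
which would tear a component apart (`rel_or_rel`). By transitivity all components are isomorphic,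
and the one-way arcs of one of them form the digraph Y (`exists_disjointCopies`).

Reflexification, complement and enlargement leave the set of copies unchanged. An embedding between
unions of complete structures sends distinct components into distinct components, so a copy is a
choice of κ components with a copy inside each (`nonempty_sub_disjointCopies_iff`). For finite κ
this gives a power of P(Y), for infinite κ the families with infinite support. If Y is disconnected,
the decomposition applies to Y once more and its components are tournaments, whence (i).

For (ii), the separative order on infinitely supported families is a coordinatewise comparison
modulo finitely many coordinates. A diagonal choice of coordinates gives σ-closure, splitting a
support gives atomlessness, and both pass to powers. Under CH, every atomless σ-closed pre-order of
size at most continuum admits a dense embedding of one and the same tree of height ω₁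
(`exists_isDenseEmbedding`), so any two of them have isomorphic completions. -/

namespace BinStr

/-! ### Regular open algebras and dense embeddings -/

section Completion

variable {P : Type u} {Q : Type v} [Preorder P] [Preorder Q]

theorem mem_lowerSet_compl_iff {U : LowerSet P} {x : P} : x ∈ Uᶜ ↔ ∀ y ≤ x, y ∉ U := by
  rw [← LowerSet.Iic_le, le_compl_iff_disjoint_right, disjoint_iff_inf_le]
  constructor
  · intro h y hy hyU
    exact h (show y ∈ LowerSet.Iic x ⊓ U from ⟨hy, hyU⟩)
  · intro h y hy
    exact (h y hy.1 hy.2).elim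

theorem isRegular_lowerSet_iff {U : LowerSet P} :
    Heyting.IsRegular U ↔ ∀ x, (∀ y ≤ x, ∃ z ≤ y, z ∈ U) → x ∈ U := by
  have key : ∀ x, x ∈ Uᶜᶜ ↔ ∀ y ≤ x, ∃ z ≤ y, z ∈ U := by
    intro x
    simp only [mem_lowerSet_compl_iff, not_forall, not_not, exists_prop]
  constructor
  · intro h x hx
    rw [← h.eq]
    exact (key x).2 hx
  · intro h
    refine le_antisymm (fun x hx => h x ((key x).1 hx)) le_compl_compl

/-- Two elements of a pre-order are compatible if they have a common lower bound. -/
def Compatible (p q : P) : Prop := ∃ t, t ≤ p ∧ t ≤ q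

theorem Compatible.mono {p p' q q' : P} (h : Compatible p q) (hp : p ≤ p') (hq : q ≤ q') :
    Compatible p' q' :=
  let ⟨t, h1, h2⟩ := h
  ⟨t, h1.trans hp, h2.trans hq⟩

theorem Compatible.symm {p q : P} (h : Compatible p q) : Compatible q p :=
  let ⟨t, h1, h2⟩ := h
  ⟨t, h2, h1⟩

/-- A dense embedding of pre-orders: monotone, reflecting compatibility, with dense range. -/
structure IsDenseEmbedding (e : P → Q) : Prop where
  monotone : Monotone e
  compatible : ∀ x y, Compatible (e x) (e y) → Compatible x y
  dense : ∀ q, ∃ x, e x ≤ q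

/-- The pullback of a regular open set along a dense embedding. -/
def IsDenseEmbedding.comap {e : P → Q} (he : IsDenseEmbedding e) (U : BooleanCompletion Q) :
    BooleanCompletion P :=
  ⟨⟨{x | e x ∈ U.val}, fun _ _ h hx => U.val.lower (he.monotone h) hx⟩, by
    rw [isRegular_lowerSet_iff]
    intro x hx
    refine isRegular_lowerSet_iff.1 U.prop _ fun q hq => ?_
    obtain ⟨z, hz⟩ := he.dense q
    -- `e` need not reflect the order, so `e z ≤ e x` yields only a common lower bound of `z` and
    -- `x`. The same device recurs in `completionIso`.
    obtain ⟨y, hyz, hyx⟩ := he.compatible z x ⟨e z, le_rfl, hz.trans hq⟩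
    obtain ⟨w, hwy, hw⟩ := hx y hyx
    exact ⟨e w, (he.monotone (hwy.trans hyz)).trans hz, hw⟩⟩

/-- The pushforward of a regular open set along a dense embedding. -/
def IsDenseEmbedding.map {e : P → Q} (_ : IsDenseEmbedding e) (V : BooleanCompletion P) :
    BooleanCompletion Q :=
  ⟨⟨{q | ∀ q' ≤ q, ∃ x ∈ V.val, e x ≤ q'}, fun _ _ h hx q' hq' => hx q' (hq'.trans h)⟩, by
    rw [isRegular_lowerSet_iff]
    intro q hq q' hq'
    obtain ⟨z, hz, hzU⟩ := hq q' hq'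
    obtain ⟨x, hx, hxz⟩ := hzU z le_rfl
    exact ⟨x, hx, hxz.trans hz⟩⟩

/-- A dense embedding induces an isomorphism of Boolean completions. -/
def IsDenseEmbedding.completionIso {e : P → Q} (he : IsDenseEmbedding e) :
    BooleanCompletion P ≃o BooleanCompletion Q where
  toFun := he.map
  invFun := he.comap
  left_inv V := by
    apply Heyting.Regular.coe_injective
    apply le_antisymm
    · intro x hx
      refine isRegular_lowerSet_iff.1 V.prop x fun y hy => ?_
      obtain ⟨z, hz, hzy⟩ := hx (e y) (he.monotone hy)
      obtain ⟨w, hwz, hwy⟩ := he.compatible z y ⟨e z, le_rfl, hzy⟩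
      exact ⟨w, hwy, V.val.lower hwz hz⟩
    · intro x hx q hq
      obtain ⟨z, hz⟩ := he.dense q
      obtain ⟨w, hwz, hwx⟩ := he.compatible z x ⟨e z, le_rfl, hz.trans hq⟩
      exact ⟨w, V.val.lower hwx hx, (he.monotone hwz).trans hz⟩
  right_inv U := by
    apply Heyting.Regular.coe_injective
    apply le_antisymm
    · intro q hq
      refine isRegular_lowerSet_iff.1 U.prop q fun y hy => ?_
      obtain ⟨x, hx, hxy⟩ := hq y hy
      exact ⟨e x, hxy, hx⟩
    · intro q hq q' hq'
      obtain ⟨x, hx⟩ := he.dense q'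
      exact ⟨x, U.val.lower (hx.trans hq') hq, hx⟩
  map_rel_iff' {V W} := by
    constructor
    · intro h x hx
      refine isRegular_lowerSet_iff.1 W.prop x fun y hy => ?_
      have hy' : e y ∈ (he.map V).val := by
        intro q hq
        obtain ⟨z, hz⟩ := he.dense q
        obtain ⟨w, hwz, hwy⟩ := he.compatible z y ⟨e z, le_rfl, hz.trans hq⟩
        exact ⟨w, V.val.lower (hwy.trans hy) hx, (he.monotone hwz).trans hz⟩
      obtain ⟨z, hz, hzy⟩ := h hy' (e y) le_rfl
      obtain ⟨w, hwz, hwy⟩ := he.compatible z y ⟨e z, le_rfl, hzy⟩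
      exact ⟨w, hwy, W.val.lower hwz hz⟩
    · intro h q hq q' hq'
      obtain ⟨x, hx, hxq⟩ := hq q' hq'
      exact ⟨x, h hx, hxq⟩

end Completion

/-! ### σ-closed pre-orders and their antichains -/

section SigmaClosed

variable {P : Type u} [Preorder P]

/-- Every decreasing sequence of length `ω` has a lower bound. -/
def IsSigmaClosed (P : Type u) [Preorder P] : Prop :=
  ∀ p : ℕ → P, Antitone p → ∃ q, ∀ n, q ≤ p n

theorem IsSigmaClosed.exists_lowerBound (h : IsSigmaClosed P) [Nonempty P] {ι : Type v}
    [LinearOrder ι] [Countable ι] (p : ι → P) (hp : ∀ i j, i < j → p j ≤ p i) :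
    ∃ q, ∀ i, q ≤ p i := by
  have hp' : Antitone p := fun i j hij => by
    rcases hij.lt_or_eq with hij | rfl
    · exact hp i j hij
    · exact le_rfl
  rcases isEmpty_or_nonempty ι with hι | hι
  · exact ⟨Classical.arbitrary P, fun i => hι.elim i⟩
  · obtain ⟨f, hf⟩ := exists_surjective_nat ι
    -- The running maxima of an enumeration of `ι` form a cofinal increasing sequence.
    obtain ⟨q, hq⟩ := h (fun n => p (partialSups f n))
      (fun m n hmn => hp' ((partialSups f).monotone hmn))
    refine ⟨q, fun i => ?_⟩
    obtain ⟨n, rfl⟩ := hf i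
    exact (hq n).trans (hp' (le_partialSups f n))

theorem IsSigmaClosed.isClosedOrder (h : IsSigmaClosed P) [Nonempty P] :
    IsClosedOrder (Cardinal.aleph.{0} 1) P := by
  intro γ hγ p hp
  have : Countable (Set.Iio γ) := by
    rw [← Cardinal.mk_le_aleph0_iff, Cardinal.mk_Iio_ordinal, ← Cardinal.lift_aleph0.{1, 0},
      Cardinal.lift_le, ← Order.lt_succ_iff, Cardinal.succ_aleph0]
    exact Cardinal.lt_ord.1 hγ
  exact h.exists_lowerBound p hp

/-- Below every element of an atomless `σ`-closed pre-order there are continuum many pairwise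
incompatible elements. -/
theorem IsSigmaClosed.exists_antichain (h : IsSigmaClosed P) (ha : IsAtomlessOrder P) (p : P) :
    ∃ g : Set ℕ → P, (∀ c, g c ≤ p) ∧ ∀ c d, Compatible (g c) (g d) → c = d := by
  classical
  have hs : ∀ p : P, ∃ a b : P, a ≤ p ∧ b ≤ p ∧ ¬ Compatible a b := by
    intro p
    have := ha p
    simp only [IsForcingAtom, not_forall] at this
    obtain ⟨a, b, h1, h2, h3⟩ := this
    exact ⟨a, b, h1, h2, h3⟩
  choose a b hap hbp hab using hs
  -- The branch of a binary tree of splittings that turns to `a` exactly at the stages in `c`.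
  let s : Set ℕ → ℕ → P := fun c n =>
    Nat.rec p (fun n q => if n ∈ c then a q else b q) n
  have hs0 : ∀ c, s c 0 = p := fun c => rfl
  have hs1 : ∀ c n, s c (n + 1) = if n ∈ c then a (s c n) else b (s c n) := fun c n => rfl
  have hanti : ∀ c, Antitone (s c) := by
    intro c
    refine antitone_nat_of_succ_le fun n => ?_
    rw [hs1]
    split_ifs
    · exact hap _
    · exact hbp _
  choose g hg using fun c => h (s c) (hanti c)
  refine ⟨g, fun c => hg c 0, fun c d hcd => ?_⟩
  have hlev : ∀ n, Compatible (s c n) (s d n) := fun n => hcd.mono (hg c n) (hg d n)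
  have hdec : ∀ n, s c n = s d n → (n ∈ c ↔ n ∈ d) := by
    intro n hn
    have := hlev (n + 1)
    rw [hs1, hs1, hn] at this
    by_cases h1 : n ∈ c <;> by_cases h2 : n ∈ d <;> simp only [h1, h2, if_true, if_false] at this ⊢
    · exact (hab _ this).elim
    · exact (hab _ this.symm).elim
  have heq : ∀ n, s c n = s d n := by
    intro n
    induction n with
    | zero => rfl
    | succ n ih => rw [hs1, hs1, ih]; simp only [hdec n ih]
  ext n
  exact hdec n (heq n)

/-- In an atomless `σ`-closed pre-order of size at most continuum each non-empty lower set has a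
maximal antichain of size continuum consisting of elements which decide a given element. -/
theorem IsSigmaClosed.exists_maximal_antichain (h : IsSigmaClosed P) (ha : IsAtomlessOrder P)
    {i : P → Set ℕ} (hi : Function.Injective i) (D : Set P) (hD : IsLowerSet D)
    (hne : D.Nonempty) (p : P) :
    ∃ g : Set ℕ → P, (∀ c, g c ∈ D) ∧ (∀ c, Compatible (g c) p → g c ≤ p) ∧
      (∀ c d, Compatible (g c) (g d) → c = d) ∧ ∀ q ∈ D, ∃ c, Compatible q (g c) := by
  classical
  obtain ⟨q₀, hq₀⟩ := hne
  obtain ⟨g₀, hg₀, hg₀'⟩ := h.exists_antichain ha q₀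
  have hdec : ∀ q : P, ∃ q' ≤ q, Compatible q' p → q' ≤ p := by
    intro q
    by_cases hq : Compatible q p
    · obtain ⟨t, h1, h2⟩ := hq
      exact ⟨t, h1, fun _ => h2⟩
    · exact ⟨q, le_rfl, fun h => (hq h).elim⟩
  choose d hd hdp using hdec
  let S : Set (Set P) := {M | (∀ x ∈ M, x ∈ D ∧ (Compatible x p → x ≤ p)) ∧
    ∀ x ∈ M, ∀ y ∈ M, Compatible x y → x = y}
  have hg₁ : ∀ c e, Compatible (d (g₀ c)) (d (g₀ e)) → c = e := fun c e hce =>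
    hg₀' _ _ (hce.mono (hd _) (hd _))
  have hM₀ : Set.range (fun c => d (g₀ c)) ∈ S := by
    constructor
    · rintro _ ⟨c, rfl⟩
      exact ⟨hD ((hd _).trans (hg₀ c)) hq₀, hdp _⟩
    · rintro _ ⟨c, rfl⟩ _ ⟨e, rfl⟩ hce
      rw [hg₁ c e hce]
  obtain ⟨M, hM₀M, hM⟩ := zorn_subset_nonempty S (by
    -- Zorn is applied above an antichain of size continuum, so the maximal one is large as well as
    -- maximal.
    intro c hcS hc _
    refine ⟨⋃₀ c, ⟨?_, ?_⟩, fun s hs => Set.subset_sUnion_of_mem hs⟩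
    · rintro x ⟨s, hs, hx⟩
      exact (hcS hs).1 x hx
    · rintro x ⟨s, hs, hx⟩ y ⟨t, ht, hy⟩ hxy
      rcases hc.total hs ht with hst | hts
      · exact (hcS ht).2 x (hst hx) y hy hxy
      · exact (hcS hs).2 x hx y (hts hy) hxy) _ hM₀
  -- `M` contains continuum many elements and injects into `Set ℕ` through `i`, so `Set ℕ` indexes
  -- it bijectively.
  obtain ⟨g, hg⟩ := Function.Embedding.schroeder_bernstein
    (f := fun c : Set ℕ => (⟨d (g₀ c), hM₀M ⟨c, rfl⟩⟩ : M)) (g := fun x : M => i x)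
    (fun c e hce => hg₁ c e (by
      have := congrArg Subtype.val hce
      simp only at this
      rw [this]
      exact ⟨_, le_rfl, le_rfl⟩))
    (fun x y hxy => Subtype.ext (hi hxy))
  refine ⟨fun c => g c, fun c => (hM.prop.1 _ (g c).2).1, fun c => (hM.prop.1 _ (g c).2).2,
    fun c e hce => hg.1 (Subtype.ext (hM.prop.2 _ (g c).2 _ (g e).2 hce)), fun q hq => ?_⟩
  by_contra hcon
  push Not at hcon
  have hq' : ∀ x ∈ M, ¬ Compatible q x := by
    intro x hx
    obtain ⟨c, hc⟩ := hg.2 ⟨x, hx⟩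
    have := hcon c
    rwa [hc] at this
  have hins : insert (d q) M ∈ S := by
    constructor
    · rintro x (rfl | hx)
      · exact ⟨hD (hd q) hq, hdp q⟩
      · exact hM.prop.1 x hx
    · rintro x (rfl | hx) y (rfl | hy) hxy
      · rfl
      · exact (hq' y hy (hxy.mono (hd q) le_rfl)).elim
      · exact (hq' x hx (hxy.symm.mono (hd q) le_rfl)).elim
      · exact hM.prop.2 x hx y hy hxy
  have hmem : d q ∈ M := hM.le_of_ge hins (Set.subset_insert _ _) (Set.mem_insert _ _)
  exact hq' _ hmem ⟨d q, hd q, le_rfl⟩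

end SigmaClosed

/-- Nodes of the complete `Set ℕ`-branching tree of height `Ω`: a level together with a branch, of
which only the values up to the level matter. -/
structure TreeNode (Ω : Type u) where
  /-- The level of the node. -/
  level : Ω
  /-- A branch through the node. -/
  path : Ω → Set ℕ

/-- A node is below another one if it extends it. -/
instance TreeNode.instPreorder (Ω : Type u) [LinearOrder Ω] : Preorder (TreeNode Ω) where
  le a b := b.level ≤ a.level ∧ ∀ γ ≤ b.level, a.path γ = b.path γ
  le_refl a := ⟨le_rfl, fun _ _ => rfl⟩
  le_trans a b c hab hbc :=
    ⟨hbc.1.trans hab.1, fun γ hγ => (hab.2 γ (hγ.trans hbc.1)).trans (hbc.2 γ hγ)⟩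

/-! ### The dense tree of height ω₁ -/

section Tree

variable {Ω : Type u} [LinearOrder Ω] [WellFoundedLT Ω] {P : Type v}

/-- The labelling of a tree determined by a rule which labels the immediate successors of a
branch. -/
noncomputable def treeLabel (child : ∀ α : Ω, (Set.Iio α → P) → Set ℕ → P) (α : Ω) :
    (Ω → Set ℕ) → P :=
  WellFoundedLT.fix (motive := fun _ => (Ω → Set ℕ) → P)
    (fun α ih b => child α (fun γ => ih γ.1 γ.2 b) (b α)) α

theorem treeLabel_eq (child : ∀ α : Ω, (Set.Iio α → P) → Set ℕ → P) (α : Ω) (b : Ω → Set ℕ) :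
    treeLabel child α b = child α (fun γ => treeLabel child γ b) (b α) := by
  rw [treeLabel, WellFoundedLT.fix_eq]
  rfl

theorem treeLabel_congr (child : ∀ α : Ω, (Set.Iio α → P) → Set ℕ → P) (α : Ω)
    {b c : Ω → Set ℕ} (h : ∀ γ ≤ α, b γ = c γ) : treeLabel child α b = treeLabel child α c := by
  induction α using WellFoundedLT.induction with
  | ind α ih =>
    rw [treeLabel_eq, treeLabel_eq, h α le_rfl]
    congr 1
    funext γ
    exact ih γ γ.2 fun δ hδ => h δ (hδ.trans (le_of_lt γ.2))

variable [Preorder P]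

/-- Under these hypotheses `P` has a dense subset isomorphic to a complete tree. -/
theorem IsSigmaClosed.exists_isDenseEmbedding [Nonempty P] (h : IsSigmaClosed P)
    (ha : IsAtomlessOrder P) {i : P → Set ℕ} (hi : Function.Injective i)
    (hΩ : ∀ α : Ω, (Set.Iio α).Countable) {e : Ω → P} (he : Function.Surjective e) :
    ∃ f : TreeNode Ω → P, IsDenseEmbedding f := by
  -- The successors of a branch `l` form a maximal antichain among its lower bounds, each member
  -- deciding `e α`: it lies below `e α` or is incompatible with it.
  have hchild : ∀ (α : Ω) (l : Set.Iio α → P), ∃ g : Set ℕ → P, (∃ q, ∀ γ, q ≤ l γ) →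
      (∀ c γ, g c ≤ l γ) ∧ (∀ c, Compatible (g c) (e α) → g c ≤ e α) ∧
      (∀ c d, Compatible (g c) (g d) → c = d) ∧
      ∀ q, (∀ γ, q ≤ l γ) → ∃ c, Compatible q (g c) := by
    intro α l
    by_cases hl : ∃ q, ∀ γ, q ≤ l γ
    · obtain ⟨g, hg⟩ := h.exists_maximal_antichain ha hi {q | ∀ γ, q ≤ l γ}
        (fun a b hba hb γ => hba.trans (hb γ)) hl (e α)
      exact ⟨g, fun _ => hg⟩
    · exact ⟨fun _ => e α, fun h => (hl h).elim⟩
  choose child hchild using hchild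
  set F := treeLabel child with hF
  have hlb : ∀ (α : Ω) (l : Set.Iio α → P), (∀ β γ, β < γ → l γ ≤ l β) → ∃ q, ∀ γ, q ≤ l γ := by
    intro α l hl
    have := (hΩ α).to_subtype
    exact h.exists_lowerBound l hl
  have hmono : ∀ α b, ∀ γ < α, F α b ≤ F γ b := by
    intro α b
    induction α using WellFoundedLT.induction with
    | ind α ih =>
      intro γ hγ
      rw [hF, treeLabel_eq]
      exact (hchild α _ (hlb α _ fun β γ hβγ => ih γ γ.2 β hβγ)).1 _ ⟨γ, hγ⟩
  have hspec := fun (α : Ω) (b : Ω → Set ℕ) =>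
    hchild α (fun γ => F γ b) (hlb α _ fun β γ hβγ => hmono γ b β hβγ)
  -- Every level is predense. A branch is built recursively as triples (branch value, label,
  -- witness), the witnesses decreasing below `q` and below the labels; σ-closure carries them
  -- through limits.
  have hdense : ∀ (α : Ω) (q : P), ∃ b, Compatible q (F α b) := by
    intro α₀ q
    have hstep : ∀ (α : Ω) (l : Set.Iio α → Set ℕ × P × P), ∃ o : Set ℕ × P × P,
        (∃ r ≤ q, ∀ γ, r ≤ (l γ).2.2) → (∀ γ, (l γ).2.2 ≤ (l γ).2.1) →
        o.2.1 = child α (fun γ => (l γ).2.1) o.1 ∧ o.2.2 ≤ o.2.1 ∧ o.2.2 ≤ q ∧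
          ∀ γ, o.2.2 ≤ (l γ).2.2 := by
      intro α l
      by_cases hl : (∃ r ≤ q, ∀ γ, r ≤ (l γ).2.2) ∧ ∀ γ, (l γ).2.2 ≤ (l γ).2.1
      · obtain ⟨⟨r, hrq, hr⟩, hl⟩ := hl
        have hr' : ∀ γ, r ≤ (l γ).2.1 := fun γ => (hr γ).trans (hl γ)
        obtain ⟨c, t, htr, htc⟩ := (hchild α _ ⟨r, hr'⟩).2.2.2 r hr'
        exact ⟨(c, _, t), fun _ _ => ⟨rfl, htc, htr.trans hrq, fun γ => htr.trans (hr γ)⟩⟩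
      -- Junk value, never reached by the recursion according to `hGspec`.
      · exact ⟨(∅, q, q), fun h1 h2 => (hl ⟨h1, h2⟩).elim⟩
    choose step hstep using hstep
    let G : Ω → Set ℕ × P × P := fun α =>
      WellFoundedLT.fix (motive := fun _ => Set ℕ × P × P)
        (fun α ih => step α fun γ => ih γ.1 γ.2) α
    have hG : ∀ α, G α = step α fun γ => G γ := fun α => WellFoundedLT.fix_eq _ α
    have hGspec : ∀ α, ((G α).2.1 = child α (fun γ => (G γ).2.1) (G α).1 ∧
        (G α).2.2 ≤ (G α).2.1 ∧ (G α).2.2 ≤ q ∧ ∀ γ : Set.Iio α, (G α).2.2 ≤ (G γ).2.2) := by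
      intro α
      induction α using WellFoundedLT.induction with
      | ind α ih =>
        have hr : ∃ r ≤ q, ∀ γ : Set.Iio α, r ≤ (G γ).2.2 := by
          obtain ⟨r, hr⟩ := hlb α (fun γ => (G γ).2.2) fun β γ hβγ => (ih γ γ.2).2.2.2 ⟨β, hβγ⟩
          -- Without earlier stages `r` need not lie below `q`, so `q` itself is taken.
          rcases isEmpty_or_nonempty (Set.Iio α) with hE | ⟨⟨γ⟩⟩
          · exact ⟨q, le_rfl, fun γ => hE.elim γ⟩
          · exact ⟨r, (hr γ).trans (ih γ γ.2).2.2.1, hr⟩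
        have := hstep α (fun γ => G γ) hr fun γ => (ih γ γ.2).2.1
        rwa [← hG] at this
    have hGF : ∀ α, F α (fun γ => (G γ).1) = (G α).2.1 := by
      intro α
      induction α using WellFoundedLT.induction with
      | ind α ih =>
        rw [(hGspec α).1, hF, treeLabel_eq]
        congr 1
        funext γ
        exact ih γ γ.2
    refine ⟨fun γ => (G γ).1, (G α₀).2.2, (hGspec α₀).2.2.1, ?_⟩
    rw [hGF]
    exact (hGspec α₀).2.1
  have hmono' : Monotone fun a : TreeNode Ω => F a.level a.path := by
    intro a b hab
    refine le_trans ?_ (treeLabel_congr child b.level hab.2).le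
    rcases hab.1.lt_or_eq with hlt | heq
    · exact hmono _ _ _ hlt
    · rw [heq]
  refine ⟨fun a => F a.level a.path, hmono', ?_, ?_⟩
  · intro a b hab
    -- At a first difference the two labels would be distinct members of one antichain, hence
    -- incompatible.
    have hagree : ∀ γ, γ ≤ a.level → γ ≤ b.level → a.path γ = b.path γ := by
      intro γ
      induction γ using WellFoundedLT.induction with
      | ind γ ih =>
        intro hγa hγb
        have h1 : F a.level a.path ≤ F γ a.path :=
          hmono' (a := a) (b := ⟨γ, a.path⟩) ⟨hγa, fun _ _ => rfl⟩
        have h2 : F b.level b.path ≤ F γ b.path :=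
          hmono' (a := b) (b := ⟨γ, b.path⟩) ⟨hγb, fun _ _ => rfl⟩
        have h3 := hab.mono h1 h2
        have h4 : (fun δ : Set.Iio γ => F δ b.path) = fun δ : Set.Iio γ => F δ a.path := by
          funext δ
          refine treeLabel_congr child δ fun ε hε => ?_
          have hεγ : ε < γ := lt_of_le_of_lt hε δ.2
          exact (ih ε hεγ (hεγ.le.trans hγa) (hεγ.le.trans hγb)).symm
        rw [hF, treeLabel_eq, treeLabel_eq child γ b.path, ← hF, h4] at h3
        exact (hspec γ a.path).2.2.1 _ _ h3
    rcases le_total a.level b.level with hle | hle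
    · exact ⟨b, ⟨hle, fun γ hγ => (hagree γ hγ (hγ.trans hle)).symm⟩, le_rfl⟩
    · exact ⟨a, le_rfl, ⟨hle, fun γ hγ => hagree γ (hγ.trans hle) hγ⟩⟩
  · intro p
    obtain ⟨α, rfl⟩ := he p
    -- Level `α` decides `e α`, so a label compatible with it already lies below it.
    obtain ⟨b, hb⟩ := hdense α (e α)
    refine ⟨⟨α, b⟩, ?_⟩
    change F α b ≤ e α
    rw [hF, treeLabel_eq] at hb ⊢
    exact (hspec α b).2.1 _ hb.symm

end Tree

/-- Under the Continuum Hypothesis any two atomless `σ`-closed pre-orders of size at most continuum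
are forcing equivalent. -/
theorem forcingEquivalent_of_CH (hCH : CH) {P : Type u} {Q : Type v} [Preorder P] [Preorder Q]
    [Nonempty P] [Nonempty Q] (hP : IsSigmaClosed P) (hQ : IsSigmaClosed Q)
    (hP' : IsAtomlessOrder P) (hQ' : IsAtomlessOrder Q)
    {i : P → Set ℕ} (hi : Function.Injective i) {j : Q → Set ℕ} (hj : Function.Injective j) :
    ForcingEquivalent P Q := by
  let Ω : Type := (Cardinal.aleph.{0} 1).ord.ToType
  have hΩ : ∀ α : Ω, (Set.Iio α).Countable := by
    intro α
    rw [← Set.countable_coe_iff, ← Cardinal.mk_le_aleph0_iff, ← Order.lt_succ_iff,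
      Cardinal.succ_aleph0]
    exact (Cardinal.mk_Iio_lt α (by rw [Cardinal.mk_ord_toType, Ordinal.type_toType])).trans_eq
      (Cardinal.mk_ord_toType _)
  -- CH lists both pre-orders along ω₁, so both receive the same tree `TreeNode Ω`.
  obtain ⟨b⟩ : Nonempty (Ω ≃ Set ℕ) := by
    rw [← Cardinal.eq, Cardinal.mk_ord_toType, Cardinal.mk_set, Cardinal.mk_nat]
    exact hCH.symm
  obtain ⟨f, hf⟩ := hP.exists_isDenseEmbedding hP' hi hΩ
    (e := Function.invFun i ∘ b) ((Function.invFun_surjective hi).comp b.surjective)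
  obtain ⟨g, hg⟩ := hQ.exists_isDenseEmbedding hQ' hj hΩ
    (e := Function.invFun j ∘ b) ((Function.invFun_surjective hj).comp b.surjective)
  exact ⟨hf.completionIso.symm.trans hg.completionIso⟩

/-! ### Choosing and splitting infinite sets -/

/-- The diagonal choice behind σ-closure. The sets need not be nested; `k ≤ m k` ensures that all
but finitely many chosen points come from late sets. -/
theorem exists_injective_mem {I : Type u} {S : ℕ → Set I} (hS : ∀ n, (S n).Infinite) :
    ∃ (m : ℕ → ℕ) (g : ℕ → I), (∀ k, k ≤ m k) ∧ Function.Injective g ∧ ∀ k, g k ∈ S (m k) := by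
  classical
  obtain ⟨f, hf, hlt⟩ := exists_seq_of_forall_finset_exists (fun x : ℕ × I => x.2 ∈ S x.1)
    (fun x y => x.1 < y.1 ∧ x.2 ≠ y.2) (by
      intro s _
      obtain ⟨i, hi, his⟩ := (hS (s.sup Prod.fst + 1)).exists_notMem_finset (s.image Prod.snd)
      refine ⟨(_, i), hi, fun x hx => ⟨Nat.lt_succ_of_le (Finset.le_sup hx), ?_⟩⟩
      rintro rfl
      exact his (Finset.mem_image_of_mem _ hx))
  refine ⟨fun k => (f k).1, fun k => (f k).2,
    fun _ => StrictMono.le_apply (fun a b hab => (hlt a b hab).1), ?_, hf⟩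
  intro a b hab
  rcases lt_trichotomy a b with h | h | h
  · exact ((hlt _ _ h).2 hab).elim
  · exact h
  · exact ((hlt _ _ h).2 hab.symm).elim

theorem exists_disjoint_infinite_subsets {I : Type u} {S : Set I} (hS : S.Infinite) :
    ∃ A B : Set I, A ⊆ S ∧ B ⊆ S ∧ A.Infinite ∧ B.Infinite ∧ Disjoint A B := by
  let f := hS.natEmbedding
  have hinj : Function.Injective fun n => (f n : I) := Subtype.val_injective.comp f.injective
  refine ⟨Set.range fun n => (f (2 * n) : I), Set.range fun n => (f (2 * n + 1) : I), ?_, ?_,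
    Set.infinite_range_of_injective ?_, Set.infinite_range_of_injective ?_, ?_⟩
  · rintro _ ⟨n, rfl⟩
    exact (f _).2
  · rintro _ ⟨n, rfl⟩
    exact (f _).2
  · intro a b hab
    have := hinj hab
    omega
  · intro a b hab
    have := hinj hab
    omega
  · rw [Set.disjoint_left]
    rintro _ ⟨n, rfl⟩ ⟨m, hm⟩
    have := hinj hm
    omega

/-! ### Transfer to separative modifications, quotients and powers -/

section SepQuot

variable {P : Type u} {Q : Type v} [Preorder P] [Preorder Q]

theorem IsSigmaClosed.antisymmetrization (h : IsSigmaClosed P) :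
    IsSigmaClosed (Antisymmetrization P (· ≤ ·)) := by
  intro p hp
  obtain ⟨q, hq⟩ := h (fun n => ofAntisymmetrization _ (p n)) fun m n hmn =>
    ofAntisymmetrization_le_ofAntisymmetrization_iff.2 (hp hmn)
  refine ⟨toAntisymmetrization _ q, fun n => ?_⟩
  rw [← toAntisymmetrization_ofAntisymmetrization (· ≤ ·) (p n)]
  exact toAntisymmetrization_le_toAntisymmetrization_iff.2 (hq n)

theorem IsAtomlessOrder.antisymmetrization (h : IsAtomlessOrder P) :
    IsAtomlessOrder (Antisymmetrization P (· ≤ ·)) := by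
  intro p hp
  refine h (ofAntisymmetrization _ p) fun q r hq hr => ?_
  obtain ⟨t, htq, htr⟩ := hp (toAntisymmetrization _ q) (toAntisymmetrization _ r)
    (by rw [← toAntisymmetrization_ofAntisymmetrization (· ≤ ·) p]
        exact toAntisymmetrization_le_toAntisymmetrization_iff.2 hq)
    (by rw [← toAntisymmetrization_ofAntisymmetrization (· ≤ ·) p]
        exact toAntisymmetrization_le_toAntisymmetrization_iff.2 hr)
  refine ⟨ofAntisymmetrization _ t, ?_, ?_⟩ <;>
    rw [← toAntisymmetrization_le_toAntisymmetrization_iff,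
      toAntisymmetrization_ofAntisymmetrization] <;> assumption

theorem SepMod.le_of_le {p q : P} (h : p ≤ q) : SepMod.mk p ≤ SepMod.mk q :=
  fun r hr => ⟨r, le_rfl, hr.trans h⟩

theorem IsAtomlessOrder.sepMod (h : IsAtomlessOrder P) : IsAtomlessOrder (SepMod P) := by
  rintro ⟨p⟩ hp
  refine h p fun q r hq hr => ?_
  obtain ⟨⟨t⟩, htq, htr⟩ := hp ⟨q⟩ ⟨r⟩ (SepMod.le_of_le hq) (SepMod.le_of_le hr)
  obtain ⟨t₁, ht₁, ht₁q⟩ := htq t le_rfl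
  obtain ⟨t₂, ht₂, ht₂r⟩ := htr t₁ ht₁
  exact ⟨t₂, ht₂.trans ht₁q, ht₂r⟩

theorem IsAtomlessOrder.of_orderIso (h : IsAtomlessOrder P) (e : P ≃o Q) :
    IsAtomlessOrder Q := by
  intro p hp
  refine h (e.symm p) fun q r hq hr => ?_
  obtain ⟨t, htq, htr⟩ := hp (e q) (e r) (e.le_symm_apply.1 hq) (e.le_symm_apply.1 hr)
  exact ⟨e.symm t, e.symm_apply_le.2 htq, e.symm_apply_le.2 htr⟩

theorem IsSigmaClosed.sepMod_of_orderIso (h : IsSigmaClosed (SepMod P)) (e : P ≃o Q) :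
    IsSigmaClosed (SepMod Q) := by
  intro p hp
  obtain ⟨⟨q⟩, hq⟩ := h (fun n => ⟨e.symm (p n).val⟩) (by
    intro m n hmn r hr
    obtain ⟨t, ht, ht'⟩ := hp hmn (e r) (e.le_symm_apply.1 hr)
    exact ⟨e.symm t, e.symm_apply_le.2 ht, e.symm.monotone ht'⟩)
  refine ⟨⟨e q⟩, fun n r hr => ?_⟩
  obtain ⟨t, ht, ht'⟩ := hq n (e.symm r) (e.symm_apply_le.2 hr)
  exact ⟨e t, e.le_symm_apply.1 ht, e.le_symm_apply.1 ht'⟩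

theorem IsAtomlessOrder.pi (h : IsAtomlessOrder P) {ι : Type w} [Nonempty ι] :
    IsAtomlessOrder (ι → P) := by
  classical
  intro p hp
  obtain ⟨i⟩ := ‹Nonempty ι›
  refine h (p i) fun q r hq hr => ?_
  obtain ⟨t, htq, htr⟩ := hp (Function.update p i q) (Function.update p i r)
    (update_le_self_iff.2 hq) (update_le_self_iff.2 hr)
  exact ⟨t i, by simpa using htq i, by simpa using htr i⟩

/-- A coordinate is tested by altering `p` there alone; conversely, refinements are chosen
coordinatewise. -/
theorem SepMod.mk_pi_le_iff {ι : Type w} {p q : ι → P} :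
    SepMod.mk p ≤ SepMod.mk q ↔ ∀ i, SepMod.mk (p i) ≤ SepMod.mk (q i) := by
  classical
  constructor
  · intro h i r hr
    obtain ⟨t, ht, ht'⟩ := h (Function.update p i r) (update_le_self_iff.2 hr)
    exact ⟨t i, by simpa using ht i, ht' i⟩
  · intro h r hr
    choose t ht ht' using fun i => h i (r i) (hr i)
    exact ⟨t, ht, ht'⟩

theorem IsSigmaClosed.sepMod_pi (h : IsSigmaClosed (SepMod P)) {ι : Type w} :
    IsSigmaClosed (SepMod (ι → P)) := by
  intro p hp
  choose q hq using fun i => h (fun n => ⟨(p n).val i⟩) fun m n hmn =>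
    SepMod.mk_pi_le_iff.1 (hp hmn) i
  exact ⟨⟨fun i => (q i).val⟩, fun n => SepMod.mk_pi_le_iff.2 fun i => hq i n⟩

end SepQuot

/-! ### Families with infinite support -/

section InfiniteSupport

/-- Families of elements of `Q` defined on an infinite subset of `I`. -/
abbrev InfiniteSupport (I : Type u) (Q : Type v) : Type (max u v) :=
  {f : I → WithBot Q // {i | f i ≠ ⊥}.Infinite}

variable {I : Type u} {Q : Type v} [PartialOrder Q]

/-- Each non-bottom element below `a` has a non-bottom element below it which is below `b`. -/
def SepLE (a b : WithBot Q) : Prop := ∀ c ≤ a, c ≠ ⊥ → ∃ d ≤ c, d ≠ ⊥ ∧ d ≤ b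

theorem bot_sepLE (b : WithBot Q) : SepLE ⊥ b := fun _ hc hne => (hne (le_bot_iff.1 hc)).elim

/-- Finitely many bad coordinates can be dropped from the support of any refinement. Infinitely many
would support a family below `f` with no refinement below `g`. -/
theorem InfiniteSupport.sepMod_le_iff {f g : InfiniteSupport I Q} :
    SepMod.mk f ≤ SepMod.mk g ↔ {i | ¬ SepLE (f.1 i) (g.1 i)}.Finite := by
  classical
  constructor
  · intro h
    by_contra hinf
    have hc : ∀ i, ¬ SepLE (f.1 i) (g.1 i) →
        ∃ c ≤ f.1 i, c ≠ ⊥ ∧ ∀ d ≤ c, d ≠ ⊥ → ¬ d ≤ g.1 i := by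
      intro i hi
      simp only [SepLE, not_forall, not_exists, not_and] at hi
      obtain ⟨c, h1, h2, h3⟩ := hi
      exact ⟨c, h1, h2, h3⟩
    choose! c hc1 hc2 hc3 using hc
    let r : I → WithBot Q := fun i => if SepLE (f.1 i) (g.1 i) then ⊥ else c i
    have hr : {i | r i ≠ ⊥} = {i | ¬ SepLE (f.1 i) (g.1 i)} := by
      ext i
      by_cases hi : SepLE (f.1 i) (g.1 i)
      · simp [r, hi]
      · simp [r, hi, hc2 i hi]
    obtain ⟨t, ht, htg⟩ := h ⟨r, by rw [hr]; exact hinf⟩ (by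
      intro i
      by_cases hi : SepLE (f.1 i) (g.1 i)
      · simp [r, hi]
      · simpa [r, hi] using hc1 i hi)
    obtain ⟨i, hi⟩ := t.2.nonempty
    have hti : t.1 i ≤ r i := ht i
    by_cases hi' : SepLE (f.1 i) (g.1 i)
    · simp only [r, hi', if_true, le_bot_iff] at hti
      exact hi hti
    · simp only [r, hi', if_false] at hti
      exact hc3 i hi' _ hti hi (htg i)
  · intro hfin r hr
    have hd : ∀ i, r.1 i ≠ ⊥ → SepLE (f.1 i) (g.1 i) → ∃ d ≤ r.1 i, d ≠ ⊥ ∧ d ≤ g.1 i :=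
      fun i hi hs => hs _ (hr i) hi
    choose! d hd1 hd2 hd3 using hd
    let t : I → WithBot Q := fun i => if r.1 i ≠ ⊥ ∧ SepLE (f.1 i) (g.1 i) then d i else ⊥
    have ht : {i | r.1 i ≠ ⊥} \ {i | ¬ SepLE (f.1 i) (g.1 i)} ⊆ {i | t i ≠ ⊥} := by
      rintro i ⟨hi, hi'⟩
      have hi'' : r.1 i ≠ ⊥ ∧ SepLE (f.1 i) (g.1 i) := ⟨hi, not_not.1 hi'⟩
      simpa [t, hi''] using hd2 i hi''.1 hi''.2
    refine ⟨⟨t, (r.2.sdiff hfin).mono ht⟩, fun i => ?_, fun i => ?_⟩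
    · by_cases hi : r.1 i ≠ ⊥ ∧ SepLE (f.1 i) (g.1 i)
      · simpa only [t, if_pos hi] using hd1 i hi.1 hi.2
      · simp only [t, if_neg hi, bot_le]
    · by_cases hi : r.1 i ≠ ⊥ ∧ SepLE (f.1 i) (g.1 i)
      · simpa only [t, if_pos hi] using hd3 i hi.1 hi.2
      · simp only [t, if_neg hi, bot_le]

/-- A pseudo-intersection: the lower bound takes the value of `p (m k)` at the chosen coordinate `g
k` and is ⊥ elsewhere, so its comparison with `p n` can fail only at `g k` with `k < n`. -/
theorem InfiniteSupport.isSigmaClosed_sepMod : IsSigmaClosed (SepMod (InfiniteSupport I Q)) := by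
  classical
  intro p hp
  have hT : ∀ n, {i | (p n).val.1 i ≠ ⊥ ∧
      ∀ k ≤ n, SepLE ((p n).val.1 i) ((p k).val.1 i)}.Infinite := by
    intro n
    have hfin : (⋃ k ∈ Set.Iic n, {i | ¬ SepLE ((p n).val.1 i) ((p k).val.1 i)}).Finite :=
      (Set.finite_Iic n).biUnion fun k hk => InfiniteSupport.sepMod_le_iff.1 (hp hk)
    refine ((p n).val.2.sdiff hfin).mono ?_
    rintro i ⟨hi, hi'⟩
    refine ⟨hi, fun k hk => ?_⟩
    by_contra hs
    exact hi' (Set.mem_biUnion (show k ∈ Set.Iic n from hk) hs)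
  obtain ⟨m, g, hm, hg, hmem⟩ := exists_injective_mem hT
  let q : I → WithBot Q := Function.extend g (fun k => (p (m k)).val.1 (g k)) ⊥
  have hq : ∀ k, q (g k) = (p (m k)).val.1 (g k) := fun k => hg.extend_apply _ _ _
  refine ⟨⟨⟨q, (Set.infinite_range_of_injective hg).mono ?_⟩⟩, fun n => ?_⟩
  · rintro _ ⟨k, rfl⟩
    rw [Set.mem_ofPred_eq, hq]
    exact (hmem k).1
  · refine InfiniteSupport.sepMod_le_iff.2 (((Set.finite_Iio n).image g).subset ?_)
    intro i hi
    by_cases hig : ∃ k, g k = i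
    · obtain ⟨k, rfl⟩ := hig
      refine ⟨k, ?_, rfl⟩
      by_contra hk
      refine hi ?_
      change SepLE (q (g k)) _
      rw [hq]
      exact (hmem k).2 n ((not_lt.1 hk).trans (hm k))
    · refine (hi ?_).elim
      change SepLE (q i) _
      rw [show q i = ⊥ from Function.extend_apply' _ _ _ hig]
      exact bot_sepLE _

theorem InfiniteSupport.isAtomlessOrder : IsAtomlessOrder (InfiniteSupport I Q) := by
  classical
  intro p hp
  obtain ⟨A, B, hA, hB, hAi, hBi, hAB⟩ := exists_disjoint_infinite_subsets p.2
  have hres : ∀ C ⊆ {i | p.1 i ≠ ⊥}, C.Infinite →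
      {i | (if i ∈ C then p.1 i else ⊥) ≠ ⊥}.Infinite := fun C hC hCi =>
    hCi.mono fun i hi => by simpa [hi] using hC hi
  have hle : ∀ (C : Set I) (i : I), (if i ∈ C then p.1 i else ⊥) ≤ p.1 i := fun C i => by
    split_ifs
    · exact le_rfl
    · exact bot_le
  obtain ⟨t, htA, htB⟩ := hp ⟨fun i => if i ∈ A then p.1 i else ⊥, hres A hA hAi⟩
    ⟨fun i => if i ∈ B then p.1 i else ⊥, hres B hB hBi⟩ (hle A) (hle B)
  obtain ⟨i, hi⟩ := t.2.nonempty
  have h1 : t.1 i ≤ if i ∈ A then p.1 i else ⊥ := htA i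
  have h2 : t.1 i ≤ if i ∈ B then p.1 i else ⊥ := htB i
  by_cases hiA : i ∈ A
  · rw [if_neg (Set.disjoint_left.1 hAB hiA), le_bot_iff] at h2
    exact hi h2
  · rw [if_neg hiA, le_bot_iff] at h1
    exact hi h1

end InfiniteSupport

/-! ### The poset (P(ω)/Fin)⁺ -/

section PowModFin

theorem AlmostSet.toAntisymmetrization_ne_iff {A : AlmostSet} :
    toAntisymmetrization (· ≤ ·) A ≠ toAntisymmetrization (· ≤ ·) (AlmostSet.mk ∅) ↔
      A.val.Infinite := by
  have h1 : A ≤ AlmostSet.mk ∅ ↔ A.val.Finite := by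
    change (A.val \ ∅).Finite ↔ _
    rw [Set.sdiff_empty]
  have h2 : AlmostSet.mk ∅ ≤ A := by
    change (∅ \ A.val).Finite
    rw [Set.empty_sdiff]
    exact Set.finite_empty
  rw [Set.Infinite, ← h1, not_iff_not]
  exact ⟨fun h => toAntisymmetrization_le_toAntisymmetrization_iff.1 h.le, fun h =>
    le_antisymm (toAntisymmetrization_le_toAntisymmetrization_iff.2 h)
      (toAntisymmetrization_le_toAntisymmetrization_iff.2 h2)⟩

/-- The class of an infinite set in `(P(ω)/Fin)⁺`. -/
noncomputable def PowModFinPos.mk (A : Set ℕ) (hA : A.Infinite) : PowModFinPos :=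
  ⟨toAntisymmetrization (· ≤ ·) ⟨A⟩, AlmostSet.toAntisymmetrization_ne_iff.2 hA⟩

theorem PowModFinPos.mk_le_iff {A B : Set ℕ} {hA : A.Infinite} {hB : B.Infinite} :
    PowModFinPos.mk A hA ≤ PowModFinPos.mk B hB ↔ (A \ B).Finite :=
  toAntisymmetrization_le_toAntisymmetrization_iff

theorem PowModFinPos.exists_mk (a : PowModFinPos) : ∃ A hA, a = PowModFinPos.mk A hA := by
  obtain ⟨a, ha⟩ := a
  induction a using Antisymmetrization.ind with
  | _ A => exact ⟨A.val, AlmostSet.toAntisymmetrization_ne_iff.1 ha, rfl⟩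

theorem PowModFinPos.isSigmaClosed : IsSigmaClosed PowModFinPos := by
  intro p hp
  choose A hA hpA using fun n => (p n).exists_mk
  have hle : ∀ {k n}, k ≤ n → (A n \ A k).Finite := by
    intro k n hkn
    have := hp hkn
    rwa [hpA, hpA, PowModFinPos.mk_le_iff] at this
  have hT : ∀ n, {i | i ∈ A n ∧ ∀ k ≤ n, i ∈ A k}.Infinite := by
    intro n
    have hfin : (⋃ k ∈ Set.Iic n, A n \ A k).Finite :=
      (Set.finite_Iic n).biUnion fun k hk => hle hk
    refine ((hA n).sdiff hfin).mono ?_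
    rintro i ⟨hi, hi'⟩
    refine ⟨hi, fun k hk => ?_⟩
    by_contra hs
    exact hi' (Set.mem_biUnion (show k ∈ Set.Iic n from hk) ⟨hi, hs⟩)
  obtain ⟨m, g, hm, hg, hmem⟩ := exists_injective_mem hT
  refine ⟨PowModFinPos.mk (Set.range g) (Set.infinite_range_of_injective hg), fun n => ?_⟩
  rw [hpA, PowModFinPos.mk_le_iff]
  refine ((Set.finite_Iio n).image g).subset ?_
  rintro _ ⟨⟨k, rfl⟩, hk⟩
  refine ⟨k, ?_, rfl⟩
  by_contra hkn
  exact hk ((hmem k).2 n ((not_lt.1 hkn).trans (hm k)))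

theorem PowModFinPos.isAtomlessOrder : IsAtomlessOrder PowModFinPos := by
  intro p hp
  obtain ⟨S, hS, rfl⟩ := p.exists_mk
  obtain ⟨A, B, hAS, hBS, hA, hB, hAB⟩ := exists_disjoint_infinite_subsets hS
  obtain ⟨t, htA, htB⟩ := hp (PowModFinPos.mk A hA) (PowModFinPos.mk B hB)
    (PowModFinPos.mk_le_iff.2 (by simp [Set.sdiff_eq_empty.2 hAS]))
    (PowModFinPos.mk_le_iff.2 (by simp [Set.sdiff_eq_empty.2 hBS]))
  obtain ⟨T, hT, rfl⟩ := t.exists_mk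
  rw [PowModFinPos.mk_le_iff] at htA htB
  refine hT ((htA.union htB).subset fun i hi => ?_)
  by_cases hiA : i ∈ A
  · exact Or.inr ⟨hi, Set.disjoint_left.1 hAB hiA⟩
  · exact Or.inl ⟨hi, hiA⟩

theorem PowModFinPos.exists_injective : ∃ j : PowModFinPos → Set ℕ, Function.Injective j := by
  choose A hA h using PowModFinPos.exists_mk
  refine ⟨A, fun a b hab => ?_⟩
  rw [h a, h b]
  congr

end PowModFin

/-- If `sq P` is obtained from a `σ`-closed separative modification, `P` is atomless and `P` has size
at most continuum, then under CH `sq P` is forcing equivalent to `(P(ω)/Fin)⁺`. -/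
theorem sepQuot_spec {P : Type u} [Preorder P] [Nonempty P] (hc : IsSigmaClosed (SepMod P))
    (ha : IsAtomlessOrder P) (hi : ∃ i : P → Set ℕ, Function.Injective i) :
    IsAtomlessOrder (SepQuot P) ∧ IsClosedOrder (Cardinal.aleph.{0} 1) (SepQuot P) ∧
      (CH → ForcingEquivalent (SepQuot P) PowModFinPos) := by
  have hne : Nonempty (SepQuot P) :=
    ⟨toAntisymmetrization _ (SepMod.mk (Classical.arbitrary P))⟩
  have hne' : Nonempty PowModFinPos := ⟨PowModFinPos.mk Set.univ Set.infinite_univ⟩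
  refine ⟨ha.sepMod.antisymmetrization, hc.antisymmetrization.isClosedOrder, fun hCH => ?_⟩
  obtain ⟨i, hi⟩ := hi
  obtain ⟨j, hj⟩ := PowModFinPos.exists_injective
  refine forcingEquivalent_of_CH hCH hc.antisymmetrization PowModFinPos.isSigmaClosed
    ha.sepMod.antisymmetrization PowModFinPos.isAtomlessOrder
    (i := fun a => i (ofAntisymmetrization _ a).val) (fun a b hab => ?_) hj
  have h1 : ofAntisymmetrization (· ≤ ·) a = ofAntisymmetrization (· ≤ ·) b :=
    congrArg SepMod.mk (hi hab)
  rw [← toAntisymmetrization_ofAntisymmetrization (· ≤ ·) a, h1,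
    toAntisymmetrization_ofAntisymmetrization]

/-! ### Operations that preserve the poset of copies -/

section CopiesIso

variable {X : Type u} {Y : Type v}

/-- If the same bijections from subsets onto `X` are isomorphisms for both relations, the two sets
of copies coincide. This applies whenever each relation is recoverable from the other. -/
theorem copiesIso_of_forall_equiv {r r' : X → X → Prop}
    (h : ∀ (A : Set X) (e : A ≃ X), (∀ a b, r (e a) (e b) ↔ r a b) ↔
      ∀ a b, r' (e a) (e b) ↔ r' a b) : Nonempty (Copies r ≃o Copies r') := by
  have key : ∀ A : Set X, Nonempty (sub r A ≃r r) ↔ Nonempty (sub r' A ≃r r') := fun A =>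
    ⟨fun ⟨e⟩ => ⟨⟨e.toEquiv, fun {a b} => (h A e.toEquiv).1 (fun _ _ => e.map_rel_iff) a b⟩⟩,
      fun ⟨e⟩ => ⟨⟨e.toEquiv, fun {a b} => (h A e.toEquiv).2 (fun _ _ => e.map_rel_iff) a b⟩⟩⟩
  exact ⟨⟨Equiv.subtypeEquivRight key, Iff.rfl⟩⟩

theorem copiesIso_compl (r : X → X → Prop) : Nonempty (Copies (compl r) ≃o Copies r) :=
  copiesIso_of_forall_equiv fun A e => by simp only [compl, not_iff_not]

theorem copiesIso_reflexification {r : X → X → Prop} (hr : ∀ x, ¬ r x x) :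
    Nonempty (Copies (reflexification r) ≃o Copies r) :=
  copiesIso_of_forall_equiv fun A e => by
    have key : ∀ x y, r x y ↔ reflexification r x y ∧ x ≠ y := by
      intro x y
      constructor
      · intro h
        exact ⟨Or.inl h, by rintro rfl; exact hr x h⟩
      · rintro ⟨h | h, hne⟩
        · exact h
        · exact (hne h).elim
    constructor
    · intro h a b
      rw [key, key, h, Ne, Ne, e.injective.eq_iff, Subtype.ext_iff]
    · intro h a b
      simp only [reflexification, h, e.injective.eq_iff, Subtype.ext_iff]

theorem copiesIso_enlargement {s : X → X → Prop} (hs : IsDigraph s) :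
    Nonempty (Copies (enlargement s) ≃o Copies s) :=
  copiesIso_of_forall_equiv fun A e => by
    -- Enlargement adds only two-way pairs, so the arcs of a digraph are its one-way pairs.
    have key : ∀ x y, s x y ↔ enlargement s x y ∧ ¬ enlargement s y x := by
      intro x y
      have h1 := hs.1 x
      have h2 := hs.2 x y
      simp only [enlargement]
      grind
    constructor
    · intro h a b
      rw [key, key, h, h]
    · intro h a b
      simp only [enlargement, h, Ne, e.injective.eq_iff, Subtype.ext_iff]

theorem RelIso.nonempty_sub_image {r : X → X → Prop} {s : Y → Y → Prop} (e : r ≃r s)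
    {A : Set X} (h : Nonempty (sub r A ≃r r)) : Nonempty (sub s (e '' A) ≃r s) := by
  rw [nonempty_sub_relIso_iff] at h ⊢
  obtain ⟨f, rfl⟩ := h
  refine ⟨(e.symm.toRelEmbedding.trans f).trans e.toRelEmbedding, ?_⟩
  ext y
  simp only [Set.mem_range, Set.mem_image, exists_exists_eq_and]
  constructor
  · rintro ⟨x, rfl⟩
    exact ⟨e.symm x, rfl⟩
  · rintro ⟨x, rfl⟩
    exact ⟨e x, by simp⟩

/-- Isomorphic structures have isomorphic posets of copies. -/
def copiesIsoOfRelIso {r : X → X → Prop} {s : Y → Y → Prop} (e : r ≃r s) :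
    Copies r ≃o Copies s where
  toFun A := ⟨e '' A.1, RelIso.nonempty_sub_image e A.2⟩
  invFun B := ⟨e.symm '' B.1, RelIso.nonempty_sub_image e.symm B.2⟩
  left_inv A := Subtype.ext (by simp [Set.image_image])
  right_inv B := Subtype.ext (by simp [Set.image_image])
  map_rel_iff' := Set.image_subset_image_iff e.injective

theorem Copies.nonempty {r : X → X → Prop} [Nonempty X] (A : Copies r) : A.1.Nonempty := by
  obtain ⟨⟨e⟩⟩ := A.2
  exact ⟨_, (e.symm (Classical.arbitrary X)).2⟩

instance Copies.instNonempty (r : X → X → Prop) : Nonempty (Copies r) :=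
  ⟨⟨Set.univ, (nonempty_sub_relIso_iff r _).2 ⟨RelEmbedding.refl r, Set.range_id⟩⟩⟩

end CopiesIso

/-! ### Copies of a disjoint union of complete structures -/

section DisjointCopies

variable {I : Type u} {Y : Type v} {s : Y → Y → Prop}

/-- Any two distinct points are related, in at least one direction. -/
def IsComplete (s : Y → Y → Prop) : Prop := ∀ x y, x ≠ y → s x y ∨ s y x

theorem enlargement_isComplete (s : Y → Y → Prop) : IsComplete (enlargement s) := by
  intro x y hxy
  simp only [enlargement]
  grind

/-- The trace of a subset of a disjoint union on the copy with index `i`. -/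
def slice (A : Set (I × Y)) (i : I) : Set Y := {y | (i, y) ∈ A}

theorem subset_iff_slice_subset {A B : Set (I × Y)} : A ⊆ B ↔ ∀ i, slice A i ⊆ slice B i :=
  ⟨fun h _ _ hy => h hy, fun h p hp => h p.1 hp⟩

/-- Related points lie in one component, so completeness keeps the image of a component inside one
component. Two components cannot share a target, since distinct points there are related. -/
theorem nonempty_sub_disjointCopies_iff [Nonempty Y] (hs : IsComplete s) (A : Set (I × Y)) :
    Nonempty (sub (disjointCopies I s) A ≃r disjointCopies I s) ↔
      Nonempty (I ≃ {i | (slice A i).Nonempty}) ∧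
        ∀ i, (slice A i).Nonempty → Nonempty (sub s (slice A i) ≃r s) := by
  simp only [nonempty_sub_relIso_iff]
  have y₀ : Y := Classical.arbitrary Y
  constructor
  · rintro ⟨f, rfl⟩
    have hrel : ∀ p q, disjointCopies I s (f p) (f q) ↔ disjointCopies I s p q :=
      fun p q => f.map_rel_iff
    have hfst : ∀ i y z, (f (i, y)).1 = (f (i, z)).1 := by
      intro i y z
      by_cases hyz : y = z
      · rw [hyz]
      · rcases hs y z hyz with h | h
        · exact ((hrel (i, y) (i, z)).2 ⟨rfl, h⟩).1
        · exact ((hrel (i, z) (i, y)).2 ⟨rfl, h⟩).1.symm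
    have hinj : ∀ i j, (f (i, y₀)).1 = (f (j, y₀)).1 → i = j := by
      intro i j hij
      by_contra hne
      have hne' : (f (i, y₀)).2 ≠ (f (j, y₀)).2 := fun h =>
        hne (congrArg Prod.fst (f.injective (Prod.ext hij h)))
      rcases hs _ _ hne' with h | h
      · exact hne ((hrel (i, y₀) (j, y₀)).1 ⟨hij, h⟩).1
      · exact hne ((hrel (j, y₀) (i, y₀)).1 ⟨hij.symm, h⟩).1.symm
    have hmem : ∀ i, (slice (Set.range f) (f (i, y₀)).1).Nonempty := fun i =>
      ⟨(f (i, y₀)).2, ⟨(i, y₀), rfl⟩⟩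
    have hsurj : ∀ j, (slice (Set.range f) j).Nonempty → ∃ i, (f (i, y₀)).1 = j := by
      rintro j ⟨y, ⟨i, z⟩, hz⟩
      exact ⟨i, by rw [hfst i y₀ z, hz]⟩
    refine ⟨⟨Equiv.ofBijective (fun i => ⟨(f (i, y₀)).1, hmem i⟩) ⟨fun i j h => ?_, ?_⟩⟩, ?_⟩
    · exact hinj i j (congrArg Subtype.val h)
    · rintro ⟨j, hj⟩
      obtain ⟨i, hi⟩ := hsurj j hj
      exact ⟨i, Subtype.ext hi⟩
    · intro j hj
      obtain ⟨i, rfl⟩ := hsurj j hj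
      refine ⟨⟨⟨fun y => (f (i, y)).2, fun y z hyz => ?_⟩, fun {y z} => ?_⟩, ?_⟩
      · exact congrArg Prod.snd (f.injective (Prod.ext (hfst i y z) hyz))
      · change s (f (i, y)).2 (f (i, z)).2 ↔ s y z
        simpa [disjointCopies, hfst i y z] using hrel (i, y) (i, z)
      · ext y
        constructor
        · rintro ⟨z, rfl⟩
          exact ⟨(i, z), Prod.ext (hfst i z y₀) rfl⟩
        · rintro ⟨⟨j, z⟩, hz⟩
          have : i = j := hinj _ _ (by rw [hfst j y₀ z, hz])
          subst this
          exact ⟨z, congrArg Prod.snd hz⟩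
  · rintro ⟨⟨e⟩, h⟩
    choose g hg using fun i : I => h (e i) (e i).2
    refine ⟨⟨⟨fun p => (e p.1, g p.1 p.2), ?_⟩, ?_⟩, ?_⟩
    · rintro ⟨i, y⟩ ⟨j, z⟩ hp
      obtain ⟨h1, h2⟩ := Prod.mk.inj hp
      have hij : i = j := e.injective (Subtype.ext h1)
      subst hij
      exact Prod.ext rfl ((g i).injective h2)
    · rintro ⟨i, y⟩ ⟨j, z⟩
      constructor
      · rintro ⟨h1, h2⟩
        have hij : i = j := e.injective (Subtype.ext h1)
        subst hij
        exact ⟨rfl, (g i).map_rel_iff.1 h2⟩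
      · rintro ⟨h1, h2⟩
        change i = j at h1
        subst h1
        exact ⟨rfl, (g i).map_rel_iff.2 h2⟩
    · ext ⟨j, y⟩
      constructor
      · rintro ⟨⟨i, z⟩, hz⟩
        obtain ⟨h1, h2⟩ := Prod.mk.inj hz
        have : y ∈ slice A (e i) := by
          rw [← hg i, ← h2]
          exact ⟨z, rfl⟩
        rw [← h1]
        exact this
      · intro hy
        obtain ⟨i, hi⟩ := e.surjective ⟨j, ⟨y, hy⟩⟩
        have hij : (e i : I) = j := congrArg Subtype.val hi
        have : y ∈ Set.range (g i) := by
          rw [hg i, hij]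
          exact hy
        obtain ⟨z, rfl⟩ := this
        exact ⟨(i, z), Prod.ext hij rfl⟩

theorem copiesIso_disjointCopies_of_finite [Nonempty Y] [Finite I] (hs : IsComplete s) :
    Nonempty (Copies (disjointCopies I s) ≃o (I → Copies s)) := by
  have hne : ∀ (A : Copies (disjointCopies I s)) i, (slice A.1 i).Nonempty := by
    intro A i
    obtain ⟨e⟩ := ((nonempty_sub_disjointCopies_iff hs A.1).1 A.2).1
    -- An injection of a finite index set into itself is onto, so no slice is empty.
    obtain ⟨j, hj⟩ := Finite.surjective_of_injective
      (f := fun i => (e i : I)) (Subtype.val_injective.comp e.injective) i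
    rw [← hj]
    exact (e j).2
  refine ⟨RelIso.ofSurjective (OrderEmbedding.ofMapLEIff (fun A i =>
    ⟨slice A.1 i, ((nonempty_sub_disjointCopies_iff hs A.1).1 A.2).2 i (hne A i)⟩)
    fun A B => subset_iff_slice_subset.symm) fun F => ?_⟩
  refine ⟨⟨{p | p.2 ∈ (F p.1).1}, (nonempty_sub_disjointCopies_iff hs _).2 ⟨?_, ?_⟩⟩, rfl⟩
  · exact ⟨(Equiv.subtypeUnivEquiv fun i => (F i).nonempty).symm⟩
  · exact fun i _ => (F i).2

theorem copiesIso_disjointCopies_of_infinite [Nonempty Y] [Countable I] [Infinite I]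
    (hs : IsComplete s) :
    Nonempty (Copies (disjointCopies I s) ≃o InfiniteSupport I (Copies s)) := by
  classical
  -- The value ⊥ records an empty slice.
  let F : Copies (disjointCopies I s) → I → WithBot (Copies s) := fun A i =>
    if h : (slice A.1 i).Nonempty then
      ((⟨slice A.1 i, ((nonempty_sub_disjointCopies_iff hs A.1).1 A.2).2 i h⟩ : Copies s) :
        WithBot (Copies s))
    else ⊥
  have hF : ∀ A i, F A i ≠ ⊥ ↔ (slice A.1 i).Nonempty := by
    intro A i
    by_cases h : (slice A.1 i).Nonempty <;> simp [F, h]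
  have hle : ∀ A B i, F A i ≤ F B i ↔ slice A.1 i ⊆ slice B.1 i := by
    intro A B i
    by_cases hA : (slice A.1 i).Nonempty
    · by_cases hB : (slice B.1 i).Nonempty
      · simp only [F, hA, hB, dif_pos, WithBot.coe_le_coe]
        rfl
      · simp only [F, hA, hB, dif_pos]
        rw [Set.not_nonempty_iff_eq_empty] at hB
        simp [hB, hA.ne_empty]
    · simp only [F, hA]
      rw [Set.not_nonempty_iff_eq_empty] at hA
      simp [hA]
  have hinf : ∀ A, {i | F A i ≠ ⊥}.Infinite := by
    intro A
    obtain ⟨e⟩ := ((nonempty_sub_disjointCopies_iff hs A.1).1 A.2).1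
    simp only [hF]
    exact Set.infinite_coe_iff.1 (Infinite.of_injective e e.injective)
  refine ⟨RelIso.ofSurjective (OrderEmbedding.ofMapLEIff (fun A => ⟨F A, hinf A⟩) fun A B => ?_)
    fun G => ?_⟩
  · rw [← Subtype.coe_le_coe, ← Subtype.coe_le_coe]
    exact (forall_congr' (hle A B)).trans subset_iff_slice_subset.symm
  · let A : Set (I × Y) := {p | ∃ B : Copies s, G.1 p.1 = B ∧ p.2 ∈ B.1}
    have hslice : ∀ i (B : Copies s), G.1 i = B → slice A i = B.1 := by
      intro i B hB
      ext y
      constructor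
      · rintro ⟨B', hB', hy⟩
        rw [hB, WithBot.coe_inj] at hB'
        rwa [hB']
      · exact fun hy => ⟨B, hB, hy⟩
    have hsupp : {i | (slice A i).Nonempty} = {i | G.1 i ≠ ⊥} := by
      ext i
      constructor
      · rintro ⟨y, B, hB, -⟩
        exact ne_of_eq_of_ne hB WithBot.coe_ne_bot
      · intro hi
        obtain ⟨B, hB⟩ := WithBot.ne_bot_iff_exists.1 hi
        rw [Set.mem_ofPred_eq, hslice i B hB.symm]
        exact B.nonempty
    have hA : Nonempty (sub (disjointCopies I s) A ≃r disjointCopies I s) := by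
      refine (nonempty_sub_disjointCopies_iff hs A).2 ⟨?_, ?_⟩
      · rw [hsupp]
        have := G.2.to_subtype
        -- Any infinite support is equipotent to the countable `I`.
        exact nonempty_equiv_of_countable
      · rintro i ⟨y, B, hB, -⟩
        rw [hslice i B hB]
        exact B.2
    refine ⟨⟨A, hA⟩, Subtype.ext (funext fun i => ?_)⟩
    change F ⟨A, hA⟩ i = G.1 i
    by_cases hi : G.1 i = ⊥
    · rw [hi]
      by_contra hne
      have h1 : i ∈ {i | (slice A i).Nonempty} := (hF _ _).1 hne
      rw [hsupp] at h1
      exact h1 hi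
    · obtain ⟨B, hB⟩ := WithBot.ne_bot_iff_exists.1 hi
      have h2 : (slice A i).Nonempty := by
        rw [hslice i B hB.symm]
        exact B.nonempty
      simp only [F, h2, dif_pos, ← hB, WithBot.coe_inj]
      exact Subtype.ext (hslice i B hB.symm)

end DisjointCopies

/-! ### Disconnected ultrahomogeneous structures -/

section Ultrahomogeneous

variable {X : Type u}

theorem isConnected_iff [Nonempty X] {r : X → X → Prop} :
    IsConnected r ↔ ∀ x y, Relation.EqvGen r x y := by
  rw [IsConnected, Cardinal.eq_one_iff_unique]
  constructor
  · rintro ⟨h, -⟩ x y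
    exact Quotient.exact (h.elim (Quotient.mk _ x) (Quotient.mk _ y))
  · intro h
    refine ⟨⟨fun a b => ?_⟩, ⟨Quotient.mk _ (Classical.arbitrary X)⟩⟩
    induction a using Quotient.ind
    induction b using Quotient.ind
    exact Quotient.sound (h _ _)

theorem nontrivial_components [Nonempty X] {r : X → X → Prop} (h : ¬ IsConnected r) :
    Nontrivial (Components r) := by
  rw [isConnected_iff] at h
  push Not at h
  obtain ⟨x, y, hxy⟩ := h
  exact ⟨Quotient.mk _ x, Quotient.mk _ y, fun h => hxy (Quotient.exact h)⟩

theorem IsComplete.isConnected [Nonempty X] {r : X → X → Prop} (h : IsComplete r) :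
    IsConnected r := by
  rw [isConnected_iff]
  intro x y
  by_cases hxy : x = y
  · exact hxy ▸ Relation.EqvGen.refl x
  · rcases h x y hxy with h | h
    · exact .rel _ _ h
    · exact .symm _ _ (.rel _ _ h)

theorem IsDigraph.isConnected_compl [Nonempty X] {r : X → X → Prop} (h : IsDigraph r) :
    IsConnected (compl r) :=
  IsComplete.isConnected fun x y _ => h.2 x y

theorem eqvGen_map_iff {r : X → X → Prop} (f : r ≃r r) {x y : X} :
    Relation.EqvGen r (f x) (f y) ↔ Relation.EqvGen r x y := by
  have key : ∀ (g : r ≃r r) {x y : X}, Relation.EqvGen r x y → Relation.EqvGen r (g x) (g y) := by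
    intro g x y h
    induction h with
    | rel _ _ h => exact .rel _ _ (g.map_rel_iff.2 h)
    | refl _ => exact .refl _
    | symm _ _ _ ih => exact .symm _ _ ih
    | trans _ _ _ _ _ ih₁ ih₂ => exact .trans _ _ _ ih₁ ih₂
  exact ⟨fun h => by simpa using key f.symm h, key f⟩

/-- Ultrahomogeneity for finite tuples, repetitions allowed, which avoids handling subtypes later.
-/
theorem IsUltrahomogeneous.exists_relIso {r : X → X → Prop} (h : IsUltrahomogeneous r)
    {ι : Type v} [Finite ι] (a b : ι → X) (heq : ∀ i j, b i = b j ↔ a i = a j)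
    (hrel : ∀ i j, r (b i) (b j) ↔ r (a i) (a j)) : ∃ f : r ≃r r, ∀ i, f (a i) = b i := by
  have hc : ∀ x : Set.range a, a x.2.choose = x := fun x => x.2.choose_spec
  obtain ⟨f, hf⟩ := h (Set.range a) (Set.finite_range a) ⟨⟨fun x => b x.2.choose, fun x y hxy => by
    have := (heq _ _).1 hxy
    rwa [hc, hc, Subtype.coe_inj] at this⟩, fun {x y} => by
    change r (b _) (b _) ↔ r x y
    rw [hrel, hc, hc]⟩
  refine ⟨f, fun i => ?_⟩
  refine (hf ⟨a i, i, rfl⟩).trans ((heq _ _).2 (hc ⟨a i, i, rfl⟩))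

variable {t : X → X → Prop}

theorem IsUltrahomogeneous.transitive (h : IsUltrahomogeneous t) (ht : ∀ x, ¬ t x x) (x y : X) :
    ∃ f : t ≃r t, f x = y := by
  obtain ⟨f, hf⟩ := h.exists_relIso (fun _ : Unit => x) (fun _ => y) (by simp) (by simp [ht])
  exact ⟨f, hf ()⟩

/-- The components of a disconnected irreflexive ultrahomogeneous structure are complete. -/
theorem IsUltrahomogeneous.rel_or_rel [Nonempty X] (h : IsUltrahomogeneous t)
    (ht : ∀ x, ¬ t x x) (hd : ¬ IsConnected t) {x y : X} (hxy : Relation.EqvGen t x y)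
    (hne : x ≠ y) : t x y ∨ t y x := by
  by_contra hcon
  push Not at hcon
  have hz : ∃ z, ¬ Relation.EqvGen t x z := by
    by_contra hz
    push Not at hz
    exact hd (isConnected_iff.2 fun a b => .trans _ _ _ (.symm _ _ (hz a)) (hz b))
  obtain ⟨z, hz⟩ := hz
  have h1 : ¬ t x z := fun h => hz (.rel _ _ h)
  have h2 : ¬ t z x := fun h => hz (.symm _ _ (.rel _ _ h))
  have h3 : x ≠ z := fun h => hz (h ▸ .refl _)
  obtain ⟨f, hf⟩ := h.exists_relIso (fun i : Bool => if i then x else y)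
    (fun i : Bool => if i then x else z)
    (by simp [hne, h3, hne.symm, h3.symm]) (by simp [ht, h1, h2, hcon])
  have hfx : f x = x := by simpa using hf true
  have hfy : f y = z := by simpa using hf false
  apply hz
  have := (eqvGen_map_iff f).2 hxy
  rwa [hfx, hfy] at this

/-- A disconnected irreflexive ultrahomogeneous structure is a disjoint union of copies of the
enlargement of an ultrahomogeneous digraph. -/
theorem IsUltrahomogeneous.exists_disjointCopies [Nonempty X] (h : IsUltrahomogeneous t)
    (ht : ∀ x, ¬ t x x) (hd : ¬ IsConnected t) :
    ∃ (K : Set X) (s : K → K → Prop), Nonempty K ∧ IsDigraph s ∧ IsUltrahomogeneous s ∧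
      Nonempty (t ≃r disjointCopies (Components t) (enlargement s)) := by
  have x₀ : X := Classical.arbitrary X
  let K : Set X := {x | Relation.EqvGen t x₀ x}
  -- The two-way pairs of the complete component are discarded here and restored by the enlargement.
  let s : K → K → Prop := fun a b => t a b ∧ ¬ t b a
  have hK : ∀ a b : K, Relation.EqvGen t a b := fun a b => .trans _ _ _ (.symm _ _ a.2) b.2
  have hs : ∀ a b : K, enlargement s a b ↔ t a b := by
    intro a b
    by_cases hab : a = b
    · subst hab
      simp [enlargement, s, ht]
    · have := h.rel_or_rel ht hd (hK a b) fun h => hab (Subtype.ext h)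
      simp only [enlargement, s]
      grind
  refine ⟨K, s, ⟨⟨x₀, .refl _⟩⟩, ⟨fun x hx => hx.2 hx.1, fun x y => ?_⟩, ?_, ?_⟩
  · by_cases hxy : t x y
    · exact Or.inr fun h => h.2 hxy
    · exact Or.inl fun h => hxy h.1
  · intro A hA φ
    rcases A.eq_empty_or_nonempty with rfl | ⟨a₀, ha₀⟩
    · exact ⟨RelIso.refl s, fun a => a.2.elim⟩
    have := hA.to_subtype
    obtain ⟨f, hf⟩ := h.exists_relIso (fun a : A => ((a : K) : X)) (fun a => (φ a : X))
      (by simp [Subtype.coe_inj, φ.injective.eq_iff]) (by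
        intro a b
        have h1 : ∀ a b : A, s (φ a) (φ b) ↔ s a b := fun a b => φ.map_rel_iff
        simp only [← hs, enlargement, h1, Ne, φ.injective.eq_iff, Subtype.coe_inj])
    -- An automorphism sending one point of `K` into `K` preserves that component; hence the
    -- separate treatment of empty `A`.
    have hfK : ∀ x, x ∈ K ↔ f x ∈ K := by
      intro x
      have h1 : ∀ (a : K) (x : X), x ∈ K ↔ Relation.EqvGen t a x := fun a x =>
        ⟨fun hx => hK a ⟨x, hx⟩, fun hx => .trans _ _ _ a.2 hx⟩
      rw [h1 a₀ x, h1 (φ ⟨a₀, ha₀⟩) (f x), ← hf ⟨a₀, ha₀⟩, eqvGen_map_iff]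
    refine ⟨⟨f.toEquiv.subtypeEquiv hfK, fun {a b} => ?_⟩, fun a => Subtype.ext (hf a)⟩
    exact and_congr f.map_rel_iff (not_congr f.map_rel_iff)
  -- Each `f c` carries the component `K` of `x₀` onto the component `c`.
  · choose f hf using fun c : Components t => h.transitive ht x₀ c.out
    have hclass : ∀ (c : Components t) (y : K), Quotient.mk _ (f c y) = c := by
      intro c y
      conv_rhs => rw [← Quotient.out_eq c]
      refine Quotient.sound ?_
      change Relation.EqvGen t _ _
      rw [← hf c, eqvGen_map_iff]
      exact .symm _ _ y.2
    refine ⟨RelIso.symm ⟨Equiv.ofBijective (fun p : Components t × K => f p.1 p.2) ⟨?_, ?_⟩, ?_⟩⟩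
    · rintro ⟨c, y⟩ ⟨d, z⟩ hyz
      have hcd : c = d := by rw [← hclass c y, ← hclass d z]; exact congrArg _ hyz
      subst hcd
      exact Prod.ext rfl (Subtype.ext ((f c).injective hyz))
    · intro x
      obtain ⟨c, hc⟩ : ∃ c : Components t, c = Quotient.mk _ x := ⟨_, rfl⟩
      have hx : Relation.EqvGen t x₀ ((f c).symm x) := by
        rw [← eqvGen_map_iff (f c), hf, RelIso.apply_symm_apply]
        exact Quotient.exact ((Quotient.out_eq c).trans hc)
      exact ⟨⟨c, ⟨_, hx⟩⟩, (f c).apply_symm_apply x⟩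
    · rintro ⟨c, y⟩ ⟨d, z⟩
      change t (f c y) (f d z) ↔ c = d ∧ enlargement s y z
      rw [hs]
      constructor
      · intro hr
        have hcd : c = d := by
          rw [← hclass c y, ← hclass d z]
          exact Quotient.sound (.rel _ _ hr)
        subst hcd
        exact ⟨rfl, (f c).map_rel_iff.1 hr⟩
      · rintro ⟨rfl, hr⟩
        exact (f c).map_rel_iff.2 hr

end Ultrahomogeneous

/-! ### Representation and the posets of copies -/

section Representation

variable {X : Type u} {Y : Type v}

/-- The irreflexive part of a structure. -/
def irreflexivePart (r : X → X → Prop) : X → X → Prop := fun x y => r x y ∧ x ≠ y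

theorem reflexification_irreflexivePart {r : X → X → Prop} (hr : ∀ x, r x x) :
    reflexification (irreflexivePart r) = r := by
  funext x y
  simp only [reflexification, irreflexivePart]
  by_cases hxy : x = y
  · subst hxy
    simp [hr]
  · simp [hxy]

/-- When equality and either relation determine the other, both structures have the same finite
partial isomorphisms and the same automorphisms. -/
theorem IsUltrahomogeneous.of_forall_equiv {r r' : X → X → Prop} (h : IsUltrahomogeneous r)
    (h₁ : ∀ x y z w, (x = y ↔ z = w) → (r' x y ↔ r' z w) → (r x y ↔ r z w))
    (h₂ : ∀ x y z w, (x = y ↔ z = w) → (r x y ↔ r z w) → (r' x y ↔ r' z w)) :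
    IsUltrahomogeneous r' := by
  intro A hA φ
  have := hA.to_subtype
  have hφ : ∀ a b : A, φ a = φ b ↔ (a : X) = b := fun a b => by
    rw [φ.injective.eq_iff, Subtype.coe_inj]
  obtain ⟨f, hf⟩ := h.exists_relIso (fun a : A => (a : X)) φ hφ
    fun a b => h₁ _ _ _ _ (hφ a b) φ.map_rel_iff
  exact ⟨⟨f.toEquiv, fun {a b} => h₂ _ _ _ _ f.injective.eq_iff f.map_rel_iff⟩, hf⟩

theorem IsUltrahomogeneous.irreflexivePart {r : X → X → Prop} (h : IsUltrahomogeneous r)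
    (hr : ∀ x, r x x) : IsUltrahomogeneous (irreflexivePart r) := by
  refine h.of_forall_equiv (fun x y z w h₁ h₂ => ?_) fun x y z w h₁ h₂ => ?_
  · simp only [BinStr.irreflexivePart] at h₂
    have := hr x
    have := hr z
    grind
  · simp only [BinStr.irreflexivePart, Ne, h₁, h₂]

theorem IsUltrahomogeneous.compl {r : X → X → Prop} (h : IsUltrahomogeneous r) :
    IsUltrahomogeneous (compl r) :=
  h.of_forall_equiv (fun _ _ _ _ _ h => not_iff_not.1 h) fun _ _ _ _ _ h => not_congr h

theorem IsUltrahomogeneous.enlargement {s : X → X → Prop} (h : IsUltrahomogeneous s)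
    (hs : IsDigraph s) : IsUltrahomogeneous (enlargement s) := by
  -- An arc is read off from the reversed pair, which is why `of_forall_equiv` does not apply.
  have h' : ∀ x y, BinStr.enlargement s x y ↔ x ≠ y ∧ ¬ s y x := by
    intro x y
    have h1 := hs.1 x
    have h2 := hs.2 x y
    simp only [BinStr.enlargement]
    grind
  intro A hA φ
  have := hA.to_subtype
  have hφ : ∀ a b : A, φ a = φ b ↔ (a : X) = b := fun a b => by
    rw [φ.injective.eq_iff, Subtype.coe_inj]
  obtain ⟨f, hf⟩ := h.exists_relIso (fun a : A => (a : X)) φ hφ fun a b => by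
    have h1 : BinStr.enlargement s (φ b) (φ a) ↔ BinStr.enlargement s b a := φ.map_rel_iff
    rw [h', h'] at h1
    have h2 := hφ b a
    have h3 := hs.1 a
    have h4 := hs.1 (φ a)
    grind
  refine ⟨⟨f.toEquiv, fun {a b} => ?_⟩, hf⟩
  change BinStr.enlargement s (f a) (f b) ↔ _
  rw [h', h', f.map_rel_iff, Ne, f.injective.eq_iff]

theorem isConnected_irreflexivePart_iff [Nonempty X] {r : X → X → Prop} :
    IsConnected (irreflexivePart r) ↔ IsConnected r := by
  rw [isConnected_iff, isConnected_iff]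
  refine forall₂_congr fun x y => ⟨fun h => h.mono fun _ _ h => h.1, fun h => ?_⟩
  induction h with
  | rel x y h =>
    by_cases hxy : x = y
    · exact hxy ▸ .refl x
    · exact .rel _ _ ⟨h, hxy⟩
  | refl _ => exact .refl _
  | symm _ _ _ ih => exact .symm _ _ ih
  | trans _ _ _ _ _ ih₁ ih₂ => exact .trans _ _ _ ih₁ ih₂

/-- The complements of isomorphic structures are isomorphic. -/
def relIsoCompl {r : X → X → Prop} {s : Y → Y → Prop} (e : r ≃r s) : compl r ≃r compl s :=
  ⟨e.toEquiv, fun {_ _} => not_congr e.map_rel_iff⟩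

/-- The reflexifications of isomorphic structures are isomorphic. -/
def relIsoReflexification {r : X → X → Prop} {s : Y → Y → Prop} (e : r ≃r s) :
    reflexification r ≃r reflexification s :=
  ⟨e.toEquiv, fun {_ _} => or_congr e.map_rel_iff e.injective.eq_iff⟩

/-- The isomorphism type of a union of disjoint copies depends on the number of copies only. -/
def disjointCopiesCongr {I : Type u} {J : Type w} (e : I ≃ J) (s : Y → Y → Prop) :
    disjointCopies I s ≃r disjointCopies J s :=
  ⟨e.prodCongr (Equiv.refl Y), fun {_ _} => and_congr e.injective.eq_iff Iff.rfl⟩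

theorem compl_compl_eq (r : X → X → Prop) : compl (compl r) = r := by
  funext x y
  simp [compl]

/-- The four forms correspond to whether `r` or its complement is disconnected and whether `r` is
reflexive or irreflexive. Removing the diagonal affects neither connectedness nor ultrahomogeneity.
-/
theorem exists_isRepresentedBy {X : Type u} [Nonempty X] (r : X → X → Prop)
    (hr : (∀ x, r x x) ∨ (∀ x, ¬ r x x)) (hu : IsUltrahomogeneous r) (hb : ¬ IsBiconnected r) :
    ∃ (Y : Type u) (s : Y → Y → Prop) (κ : Cardinal.{u}), IsRepresentedBy r s κ := by
  have key : ∀ t : X → X → Prop, IsUltrahomogeneous t → (∀ x, ¬ t x x) → ¬ IsConnected t →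
      ∃ (Y : Type u) (s : Y → Y → Prop) (κ : Cardinal.{u}), IsDigraph s ∧ IsUltrahomogeneous s ∧
        1 < κ ∧ Nonempty (t ≃r disjointCopies κ.out (enlargement s)) := by
    intro t hu ht hd
    obtain ⟨K, s, -, hs, hsu, ⟨e⟩⟩ := hu.exists_disjointCopies ht hd
    refine ⟨K, s, Cardinal.mk (Components t), hs, hsu, ?_,
      ⟨e.trans (disjointCopiesCongr Cardinal.outMkEquiv.symm _)⟩⟩
    have := nontrivial_components hd
    exact Cardinal.one_lt_iff_nontrivial.2 this
  have hb' : ¬ IsConnected r ∨ ¬ IsConnected (compl r) := not_and_or.1 hb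
  rcases hb' with hd | hd <;> rcases hr with hr | hr
  · obtain ⟨Y, s, κ, h₁, h₂, h₃, ⟨e⟩⟩ := key _ (hu.irreflexivePart hr) (fun x h => h.2 rfl)
      (isConnected_irreflexivePart_iff.not.2 hd)
    refine ⟨Y, s, κ, h₁, h₂, h₃, Or.inr (Or.inl ⟨?_⟩)⟩
    have := relIsoReflexification e
    rwa [reflexification_irreflexivePart hr] at this
  · obtain ⟨Y, s, κ, h₁, h₂, h₃, h₄⟩ := key r hu hr hd
    exact ⟨Y, s, κ, h₁, h₂, h₃, Or.inl h₄⟩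
  · obtain ⟨Y, s, κ, h₁, h₂, h₃, ⟨e⟩⟩ := key _ hu.compl (fun x h => h (hr x)) hd
    refine ⟨Y, s, κ, h₁, h₂, h₃, Or.inr (Or.inr (Or.inl ⟨?_⟩))⟩
    have := relIsoCompl e
    rwa [compl_compl_eq] at this
  · obtain ⟨Y, s, κ, h₁, h₂, h₃, ⟨e⟩⟩ := key _ (hu.compl.irreflexivePart hr)
      (fun x h => h.2 rfl) (isConnected_irreflexivePart_iff.not.2 hd)
    refine ⟨Y, s, κ, h₁, h₂, h₃, Or.inr (Or.inr (Or.inr ⟨?_⟩))⟩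
    have := relIsoCompl (relIsoReflexification e)
    rwa [reflexification_irreflexivePart (fun x => hr x), compl_compl_eq] at this

theorem disjointCopies_irrefl {I : Type u} {s : Y → Y → Prop} (hs : ∀ x, ¬ s x x) (p : I × Y) :
    ¬ disjointCopies I (enlargement s) p p := by
  rintro ⟨-, h | h⟩
  · exact hs _ h
  · exact h.1 rfl

theorem IsRepresentedBy.copiesIso {r : X → X → Prop} {s : Y → Y → Prop} {κ : Cardinal.{w}}
    (h : IsRepresentedBy r s κ) :
    Nonempty (Copies r ≃o Copies (disjointCopies κ.out (enlargement s))) := by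
  obtain ⟨hs, -, -, ⟨⟨e⟩⟩ | ⟨⟨e⟩⟩ | ⟨⟨e⟩⟩ | ⟨⟨e⟩⟩⟩ := h
  · exact ⟨copiesIsoOfRelIso e⟩
  · obtain ⟨e₁⟩ := copiesIso_reflexification (disjointCopies_irrefl (I := κ.out) hs.1)
    exact ⟨(copiesIsoOfRelIso e).trans e₁⟩
  · obtain ⟨e₁⟩ := copiesIso_compl (disjointCopies κ.out (enlargement s))
    exact ⟨(copiesIsoOfRelIso e).trans e₁⟩
  · obtain ⟨e₁⟩ := copiesIso_reflexification (disjointCopies_irrefl (I := κ.out) hs.1)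
    obtain ⟨e₂⟩ := copiesIso_compl (reflexification (disjointCopies κ.out (enlargement s)))
    exact ⟨((copiesIsoOfRelIso e).trans e₂).trans e₁⟩

theorem IsRepresentedBy.nonempty_equiv {r : X → X → Prop} {s : Y → Y → Prop} {κ : Cardinal.{w}}
    (h : IsRepresentedBy r s κ) : Nonempty (X ≃ κ.out × Y) := by
  obtain ⟨-, -, -, ⟨⟨e⟩⟩ | ⟨⟨e⟩⟩ | ⟨⟨e⟩⟩ | ⟨⟨e⟩⟩⟩ := h <;> exact ⟨e.toEquiv⟩

/-- Powers of isomorphic pre-orders over equipotent index types are isomorphic. -/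
def arrowOrderIso {ι : Type*} {κ : Type*} {P : Type*} {Q : Type*} [Preorder P] [Preorder Q]
    (e : ι ≃ κ) (f : P ≃o Q) : (ι → P) ≃o (κ → Q) where
  toEquiv := e.arrowCongr f.toEquiv
  map_rel_iff' {a b} := by
    constructor
    · intro h i
      simpa using h (e i)
    · intro h i
      exact f.monotone (h (e.symm i))

/-- Currying is an isomorphism of pre-orders. -/
def curryOrderIso (ι : Type*) (κ : Type*) (P : Type*) [Preorder P] :
    (ι × κ → P) ≃o (ι → κ → P) where
  toEquiv := Equiv.curry ι κ P
  map_rel_iff' {_ _} := ⟨fun h p => h p.1 p.2, fun h i j => h (i, j)⟩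

/-- The poset of copies of an ultrahomogeneous digraph with finitely many components is a finite
power of the poset of copies of a biconnected one. -/
theorem IsDigraph.exists_biconnected {Y : Type u} [Nonempty Y] {s : Y → Y → Prop}
    (hs : IsDigraph s) (hu : IsUltrahomogeneous s) (hf : Finite (Components s)) :
    ∃ (Z J : Type u) (t : Z → Z → Prop), Finite J ∧ Nonempty J ∧
      IsDigraph t ∧ IsUltrahomogeneous t ∧ IsBiconnected t ∧
      Nonempty (Copies s ≃o (J → Copies t)) := by
  by_cases hc : IsConnected s
  · exact ⟨Y, PUnit, s, inferInstance, inferInstance, hs, hu, ⟨hc, hs.isConnected_compl⟩,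
      ⟨(OrderIso.funUnique PUnit (Copies s)).symm⟩⟩
  · obtain ⟨K, s', _, hs', hu', ⟨e⟩⟩ := hu.exists_disjointCopies hs.1 hc
    obtain ⟨e'⟩ := copiesIso_disjointCopies_of_finite (I := Components s)
      (enlargement_isComplete s')
    have hne := nontrivial_components hc
    have hemb : ∀ a b, enlargement s' a b →
        s (e.symm (Classical.arbitrary _, a)) (e.symm (Classical.arbitrary _, b)) := fun a b h =>
      e.symm.map_rel_iff.2 ⟨rfl, h⟩
    -- The enlargement embeds in the digraph `s`, so it is asymmetric: a tournament.
    have hdi : IsDigraph (enlargement s') := by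
      refine ⟨fun a h => hs.1 _ (hemb a a h), fun a b => ?_⟩
      exact (hs.2 _ _).imp (fun h h' => h (hemb a b h')) fun h h' => h (hemb b a h')
    exact ⟨K, Components s, enlargement s', hf, inferInstance, hdi, hu'.enlargement hs',
      ⟨(enlargement_isComplete s').isConnected, hdi.isConnected_compl⟩,
      ⟨(copiesIsoOfRelIso e).trans e'⟩⟩

/-- The copies of a countable ultrahomogeneous digraph with infinitely many components are the
infinitely supported families of copies of a structure. -/
theorem IsDigraph.copiesIso_infiniteSupport {Y : Type u} [Nonempty Y] [Countable Y]
    {s : Y → Y → Prop} (hs : IsDigraph s) (hu : IsUltrahomogeneous s)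
    (hi : Infinite (Components s)) :
    ∃ (Z : Type u) (t : Z → Z → Prop),
      Nonempty (Copies s ≃o InfiniteSupport (Components s) (Copies t)) := by
  have hc : ¬ IsConnected s := by
    intro hc
    rw [IsConnected, Cardinal.eq_one_iff_unique] at hc
    have := hc.1
    exact not_finite (Components s)
  have : Countable (Components s) := Quotient.countable
  obtain ⟨K, s', _, hs', hu', ⟨e⟩⟩ := hu.exists_disjointCopies hs.1 hc
  obtain ⟨e'⟩ := copiesIso_disjointCopies_of_infinite (I := Components s)
    (enlargement_isComplete s')
  exact ⟨K, enlargement s', ⟨(copiesIsoOfRelIso e).trans e'⟩⟩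

theorem Copies.exists_injective [Countable X] (r : X → X → Prop) :
    ∃ i : Copies r → Set ℕ, Function.Injective i := by
  obtain ⟨f, hf⟩ := exists_injective_nat X
  exact ⟨fun A => f '' A.1, fun A B h => Subtype.ext (Set.image_injective.2 hf h)⟩

end Representation

end BinStr

/-! ### The main theorem -/

theorem mainTheorem3 {X : Type u} [Countable X] [Nonempty X] (r : X → X → Prop)
    (hr : (∀ x, r x x) ∨ (∀ x, ¬ r x x))
    (hu : BinStr.IsUltrahomogeneous r)
    (hb : ¬ BinStr.IsBiconnected r) :
    (∃ (Y : Type u) (s : Y → Y → Prop) (κ : Cardinal.{u}), BinStr.IsRepresentedBy r s κ) ∧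
    ∀ (Y : Type u) (s : Y → Y → Prop) (κ : Cardinal.{u}), BinStr.IsRepresentedBy r s κ →
      (κ < Cardinal.aleph0 ∧ Finite (BinStr.Components s) →
        ∃ (Z : Type u) (t : Z → Z → Prop) (n : ℕ), 2 ≤ n ∧
          BinStr.IsDigraph t ∧ BinStr.IsUltrahomogeneous t ∧ BinStr.IsBiconnected t ∧
          Nonempty (BinStr.Copies r ≃o (Fin n → BinStr.Copies t))) ∧
      (κ = Cardinal.aleph0 ∨ Infinite (BinStr.Components s) →
        BinStr.IsAtomlessOrder (BinStr.SepQuot (BinStr.Copies r)) ∧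
        BinStr.IsClosedOrder (Cardinal.aleph.{0} 1) (BinStr.SepQuot (BinStr.Copies r)) ∧
        (BinStr.CH →
          BinStr.ForcingEquivalent (BinStr.SepQuot (BinStr.Copies r)) BinStr.PowModFinPos)) := by
  refine ⟨BinStr.exists_isRepresentedBy r hr hu hb, fun Y s κ h => ?_⟩
  obtain ⟨e⟩ := h.copiesIso
  obtain ⟨b⟩ := h.nonempty_equiv
  have hs := h.1
  have hsu := h.2.1
  have hκ : Nontrivial κ.out := by
    rw [← Cardinal.one_lt_iff_nontrivial, Cardinal.mk_out]
    exact h.2.2.1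
  have hY : Nonempty Y := ⟨(b (Classical.arbitrary X)).2⟩
  have hκc : Countable κ.out :=
    (b.symm.injective.comp (Prod.mk_left_injective (Classical.arbitrary Y))).countable
  have hYc : Countable Y :=
    (b.symm.injective.comp (Prod.mk_right_injective (Classical.arbitrary κ.out))).countable
  obtain ⟨e₁⟩ := BinStr.copiesIso_enlargement hs
  have hfin : κ < Cardinal.aleph0 →
      Nonempty (BinStr.Copies r ≃o (κ.out → BinStr.Copies s)) := by
    intro hlt
    have : Finite κ.out := by
      rwa [← Cardinal.lt_aleph0_iff_finite, Cardinal.mk_out]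
    obtain ⟨e₂⟩ := BinStr.copiesIso_disjointCopies_of_finite (I := κ.out)
      (BinStr.enlargement_isComplete s)
    exact ⟨(e.trans e₂).trans (BinStr.arrowOrderIso (Equiv.refl _) e₁)⟩
  constructor
  · rintro ⟨hlt, hcomp⟩
    obtain ⟨e₂⟩ := hfin hlt
    obtain ⟨Z, J, t, _, _, ht, htu, htb, ⟨e₃⟩⟩ := hs.exists_biconnected hsu hcomp
    have : Finite κ.out := by
      rwa [← Cardinal.lt_aleph0_iff_finite, Cardinal.mk_out]
    -- The exponent is at least 2 because `κ.out` is nontrivial and `J` is nonempty.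
    refine ⟨Z, t, Nat.card (κ.out × J), Finite.one_lt_card, ht, htu, htb,
      ⟨((e₂.trans (BinStr.arrowOrderIso (Equiv.refl _) e₃)).trans
        (BinStr.curryOrderIso _ _ _).symm).trans
          (BinStr.arrowOrderIso (Finite.equivFin _) (OrderIso.refl _))⟩⟩
  · intro hcase
    have hspec : BinStr.IsSigmaClosed (BinStr.SepMod (BinStr.Copies r)) ∧
        BinStr.IsAtomlessOrder (BinStr.Copies r) := by
      -- For finite κ the digraph has infinitely many components, and P(X) is a finite power of a
      -- poset of infinitely supported families. For infinite κ the copies themselves are such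
      -- families, whatever the components of `s`.
      by_cases hlt : κ < Cardinal.aleph0
      · obtain ⟨e₂⟩ := hfin hlt
        obtain ⟨Z, t, ⟨e₃⟩⟩ := hs.copiesIso_infiniteSupport hsu
          (hcase.resolve_left hlt.ne)
        have e₄ := e₂.trans (BinStr.arrowOrderIso (Equiv.refl _) e₃)
        exact ⟨BinStr.InfiniteSupport.isSigmaClosed_sepMod.sepMod_pi.sepMod_of_orderIso e₄.symm,
          BinStr.InfiniteSupport.isAtomlessOrder.pi.of_orderIso e₄.symm⟩
      · have : Infinite κ.out := by
          rw [Cardinal.infinite_iff, Cardinal.mk_out]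
          exact not_lt.1 hlt
        obtain ⟨e₂⟩ := BinStr.copiesIso_disjointCopies_of_infinite (I := κ.out)
          (BinStr.enlargement_isComplete s)
        have e₃ := e.trans e₂
        exact ⟨BinStr.InfiniteSupport.isSigmaClosed_sepMod.sepMod_of_orderIso e₃.symm,
          BinStr.InfiniteSupport.isAtomlessOrder.of_orderIso e₃.symm⟩
    exact BinStr.sepQuot_spec hspec.1 hspec.2 (BinStr.Copies.exists_injective r)
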